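/- Let $n\ge 0$. Let $(-)^*$ be the free strict $n$-category monad on $n$-globular sets, with unit $\eta$ and multiplication $\mu$, let $\mathbf 1$ be the terminal $n$-globular set, and call an $n$-globular set $G$ with a map $g:G\to\mathbf 1^*$ an $n$-globular collection. For a cell $\tau$ of $\mathbf 1^*$ of positive dimension, $\partial\tau$ denotes its source, which equals its target. The composite $G\circ H$ of collections $g:G\to\mathbf 1^*$, $h:H\to\mathbf 1^*$ is the pullback of $!^*:G^*\to\mathbf 1^*$ and $h$, mapped to $\mathbf 1^*$ by $G\circ H\to G^*\xrightarrow{g^*}\mathbf 1^{**}\xrightarrow{\mu}\mathbf 1^*$; with the unit $\eta:\mathbf 1\to\mathbf 1^*$ this makes collections a monoidal category. An $n$-globular operad is a monoid in it, with identities $\mathrm{id}_k$ and composites $\Lambda\circ(\Lambda_1,\dots,\Lambda_m)$ of the cells $((\Lambda_1,\dots,\Lambda_m),\Lambda)$ of $G\circ G$; morphisms of operads are monoid morphisms. Two $k$-cells are parallel if $k=0$, or if they have the same source and the same target. An $n$-globular operad $G$ with collection map $g$ is contractible if (i) there is a function assigning to each triple $(x,x',\tau)$, with $x,x'$ parallel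 $k$-cells of $G$, $k<n$, and $\tau$ a $(k+1)$-cell of $\mathbf 1^*$ such that $g(x)=g(x')=\partial\tau$, a $(k+1)$-cell $\chi:x\to x'$ with $g(\chi)=\tau$; and (ii) any two parallel $n$-cells $\chi,\chi'$ of $G$ with $g(\chi)=g(\chi')$ are equal. Then the following hold. 1. Let $G$ be a contractible $n$-globular operad. (a) If $n\ge 1$, then for each pair $(x,x')$ of parallel $(n-1)$-cells of $G$ and each $n$-cell $\tau$ of $\mathbf 1^*$ with $g(x)=g(x')=\partial\tau$ there is a unique $n$-cell $\chi:x\to x'$ of $G$ with $g(\chi)=\tau$. (b) For each $n$-cell $z=((\Lambda_1,\dots,\Lambda_m),\Lambda)$ of $G\circ G$, the composite $\Lambda\circ(\Lambda_1,\dots,\Lambda_m)$ is the unique $n$-cell $\chi$ of $G$ such that $g(\chi)$ is the image of $z$ in $\mathbf 1^*$ and, if $n\ge 1$, the source and the target of $\chi$ are the operadic composites of the source and of the target of $z$. 2. A contractible $n$-globular operad is determined by its $k$-cells for $k<n$: if $G$ and $H$ are contractible $n$-globular operads, then every family of bijections $G_k\to H_k$, $k<n$, that respects sources, targets, the maps to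 $\mathbf 1^*$, the identities $\mathrm{id}_k$ and the operadic composites of $k$-cells for $k<n$ extends uniquely to an isomorphism $G\cong H$ of $n$-globular operads. 3. Let $G$ and $H$ be $n$-globular operads and suppose that $H$ satisfies (ii). If two morphisms $f,f':G\to H$ of $n$-globular operads agree on all $k$-cells of $G$ for $k<n$, then $f=f'$. -/

import Mathlib

open CategoryTheory

universe u

namespace NGlob

/-! ## `n`-globular sets -/

/-- An `n`-globular set: cells in dimensions `0, …, n` with globular sources and targets. -/
structure GSet (n : ℕ) where
  cell : ∀ k : ℕ, k ≤ n → Type u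
  src : ∀ {k : ℕ} (hk : k + 1 ≤ n), cell (k + 1) hk → cell k (Nat.le_of_succ_le hk)
  tgt : ∀ {k : ℕ} (hk : k + 1 ≤ n), cell (k + 1) hk → cell k (Nat.le_of_succ_le hk)
  src_src : ∀ {k : ℕ} (hk : k + 1 + 1 ≤ n) (x : cell (k + 1 + 1) hk),
    src (Nat.le_of_succ_le hk) (src hk x) = src (Nat.le_of_succ_le hk) (tgt hk x)
  tgt_src : ∀ {k : ℕ} (hk : k + 1 + 1 ≤ n) (x : cell (k + 1 + 1) hk),
    tgt (Nat.le_of_succ_le hk) (src hk x) = tgt (Nat.le_of_succ_le hk) (tgt hk x)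

/-- A morphism of `n`-globular sets. -/
@[ext]
structure GSet.Hom {n : ℕ} (X Y : GSet.{u} n) where
  app : ∀ {k : ℕ} (hk : k ≤ n), X.cell k hk → Y.cell k hk
  app_src : ∀ {k : ℕ} (hk : k + 1 ≤ n) (x : X.cell (k + 1) hk),
    app (Nat.le_of_succ_le hk) (X.src hk x) = Y.src hk (app hk x)
  app_tgt : ∀ {k : ℕ} (hk : k + 1 ≤ n) (x : X.cell (k + 1) hk),
    app (Nat.le_of_succ_le hk) (X.tgt hk x) = Y.tgt hk (app hk x)

/-- The identity morphism. -/
def GSet.Hom.id {n : ℕ} (X : GSet.{u} n) : GSet.Hom X X where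
  app _ x := x
  app_src _ _ := rfl
  app_tgt _ _ := rfl

/-- The composite morphism. -/
def GSet.Hom.comp {n : ℕ} {X Y Z : GSet.{u} n} (f : GSet.Hom X Y) (g : GSet.Hom Y Z) :
    GSet.Hom X Z where
  app hk x := g.app hk (f.app hk x)
  app_src hk x := by rw [f.app_src, g.app_src]
  app_tgt hk x := by rw [f.app_tgt, g.app_tgt]

/-- The category of `n`-globular sets. -/
instance GSet.category (n : ℕ) : Category.{u} (GSet.{u} n) where
  Hom := GSet.Hom
  id := GSet.Hom.id
  comp := GSet.Hom.comp

theorem GSet.hom_ext {n : ℕ} {X Y : GSet.{u} n} {f g : X ⟶ Y}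
    (h : ∀ (k : ℕ) (hk : k ≤ n) (x : X.cell k hk), f.app hk x = g.app hk x) : f = g := by
  apply GSet.Hom.ext
  funext k hk x
  exact h k hk x

@[simp] theorem GSet.id_app {n : ℕ} (X : GSet.{u} n) {k : ℕ} (hk : k ≤ n) (x : X.cell k hk) :
    GSet.Hom.app (𝟙 X) hk x = x := rfl

@[simp] theorem GSet.comp_app {n : ℕ} {X Y Z : GSet.{u} n} (f : X ⟶ Y) (g : Y ⟶ Z) {k : ℕ}
    (hk : k ≤ n) (x : X.cell k hk) : (f ≫ g).app hk x = g.app hk (f.app hk x) := rfl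

/-- The iterated source `s : X_k → X_j`, for `j ≤ k`. -/
def GSet.srcTo {n : ℕ} (X : GSet.{u} n) (j : ℕ) {k : ℕ} (hjk : j ≤ k) :
    ∀ hk : k ≤ n, X.cell k hk → X.cell j (hjk.trans hk) :=
  Nat.leRec (motive := fun k hjk => ∀ hk : k ≤ n, X.cell k hk → X.cell j (hjk.trans hk))
    (fun _ x => x) (fun _ _ ih hk x => ih (Nat.le_of_succ_le hk) (X.src hk x)) hjk

/-- The iterated target `t : X_k → X_j`, for `j ≤ k`. -/
def GSet.tgtTo {n : ℕ} (X : GSet.{u} n) (j : ℕ) {k : ℕ} (hjk : j ≤ k) :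
    ∀ hk : k ≤ n, X.cell k hk → X.cell j (hjk.trans hk) :=
  Nat.leRec (motive := fun k hjk => ∀ hk : k ≤ n, X.cell k hk → X.cell j (hjk.trans hk))
    (fun _ x => x) (fun _ _ ih hk x => ih (Nat.le_of_succ_le hk) (X.tgt hk x)) hjk

section iterated

variable {n : ℕ} (X : GSet.{u} n)

theorem GSet.srcTo_self {k : ℕ} (h : k ≤ k) (hk : k ≤ n) (x : X.cell k hk) :
    X.srcTo k h hk x = x := by
  unfold GSet.srcTo; rw [Nat.leRec_self]

theorem GSet.tgtTo_self {k : ℕ} (h : k ≤ k) (hk : k ≤ n) (x : X.cell k hk) :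
    X.tgtTo k h hk x = x := by
  unfold GSet.tgtTo; rw [Nat.leRec_self]

theorem GSet.srcTo_succ {j k : ℕ} (h : j ≤ k + 1) (hjk : j ≤ k) (hk : k + 1 ≤ n)
    (x : X.cell (k + 1) hk) :
    X.srcTo j h hk x = X.srcTo j hjk (Nat.le_of_succ_le hk) (X.src hk x) := by
  unfold GSet.srcTo; rw [Nat.leRec_succ]

theorem GSet.tgtTo_succ {j k : ℕ} (h : j ≤ k + 1) (hjk : j ≤ k) (hk : k + 1 ≤ n)
    (x : X.cell (k + 1) hk) :
    X.tgtTo j h hk x = X.tgtTo j hjk (Nat.le_of_succ_le hk) (X.tgt hk x) := by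
  unfold GSet.tgtTo; rw [Nat.leRec_succ]

variable {X}

theorem GSet.Hom.app_srcTo {Y : GSet.{u} n} (f : GSet.Hom X Y) {j k : ℕ} (hjk : j ≤ k)
    (hk : k ≤ n) (x : X.cell k hk) :
    f.app (hjk.trans hk) (X.srcTo j hjk hk x) = Y.srcTo j hjk hk (f.app hk x) := by
  induction k, hjk using Nat.le_induction with
  | base => rw [GSet.srcTo_self, GSet.srcTo_self]
  | succ k h ih =>
    rw [GSet.srcTo_succ X _ h, GSet.srcTo_succ Y _ h, ← f.app_src]
    exact ih _ _

theorem GSet.Hom.app_tgtTo {Y : GSet.{u} n} (f : GSet.Hom X Y) {j k : ℕ} (hjk : j ≤ k)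
    (hk : k ≤ n) (x : X.cell k hk) :
    f.app (hjk.trans hk) (X.tgtTo j hjk hk x) = Y.tgtTo j hjk hk (f.app hk x) := by
  induction k, hjk using Nat.le_induction with
  | base => rw [GSet.tgtTo_self, GSet.tgtTo_self]
  | succ k h ih =>
    rw [GSet.tgtTo_succ X _ h, GSet.tgtTo_succ Y _ h, ← f.app_tgt]
    exact ih _ _

theorem GSet.tgtTo_src {j k : ℕ} (hjk : j < k) (hk : k + 1 ≤ n) (x : X.cell (k + 1) hk) :
    X.tgtTo j hjk.le (Nat.le_of_succ_le hk) (X.src hk x) =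
      X.tgtTo j (Nat.le_succ_of_le hjk.le) hk x := by
  obtain _ | k := k
  · omega
  · have h : j ≤ k := Nat.le_of_lt_succ hjk
    rw [X.tgtTo_succ _ h, X.tgtTo_succ _ hjk.le, X.tgtTo_succ _ h, X.tgt_src]

theorem GSet.srcTo_tgt {j k : ℕ} (hjk : j < k) (hk : k + 1 ≤ n) (x : X.cell (k + 1) hk) :
    X.srcTo j hjk.le (Nat.le_of_succ_le hk) (X.tgt hk x) =
      X.srcTo j (Nat.le_succ_of_le hjk.le) hk x := by
  obtain _ | k := k
  · omega
  · have h : j ≤ k := Nat.le_of_lt_succ hjk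
    rw [X.srcTo_succ _ h, X.srcTo_succ _ hjk.le, X.srcTo_succ _ h, X.src_src]

theorem GSet.composable_src {j k : ℕ} (hjk : j < k) (hk : k + 1 ≤ n) {x y : X.cell (k + 1) hk}
    (h : X.tgtTo j (Nat.lt_succ_of_lt hjk).le hk x = X.srcTo j (Nat.lt_succ_of_lt hjk).le hk y) :
    X.tgtTo j hjk.le (Nat.le_of_succ_le hk) (X.src hk x) =
      X.srcTo j hjk.le (Nat.le_of_succ_le hk) (X.src hk y) := by
  rw [X.tgtTo_src hjk hk, h, X.srcTo_succ _ hjk.le]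

theorem GSet.composable_tgt {j k : ℕ} (hjk : j < k) (hk : k + 1 ≤ n) {x y : X.cell (k + 1) hk}
    (h : X.tgtTo j (Nat.lt_succ_of_lt hjk).le hk x = X.srcTo j (Nat.lt_succ_of_lt hjk).le hk y) :
    X.tgtTo j hjk.le (Nat.le_of_succ_le hk) (X.tgt hk x) =
      X.srcTo j hjk.le (Nat.le_of_succ_le hk) (X.tgt hk y) := by
  rw [X.srcTo_tgt hjk hk, ← h, X.tgtTo_succ _ hjk.le]

end iterated

/-! ## Strict `n`-categories -/

/-- The data of identities and compositions on an `n`-globular set: `idt x` is the identity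
`(k+1)`-cell on a `k`-cell `x`, and `comp j x y` is the composite of the `k`-cells `x` and `y`
along their common `j`-dimensional boundary `t x = s y`, for `j < k`. -/
structure CatData (n : ℕ) extends GSet.{u} n where
  idt : ∀ {k : ℕ} (hk : k + 1 ≤ n), cell k (Nat.le_of_succ_le hk) → cell (k + 1) hk
  comp : ∀ {k : ℕ} (hk : k ≤ n) (j : ℕ) (hj : j < k) (x y : cell k hk),
    toGSet.tgtTo j hj.le hk x = toGSet.srcTo j hj.le hk y → cell k hk

/-- The iterated identity `X_j → X_k`, for `j ≤ k`. -/
def CatData.idTo {n : ℕ} (C : CatData.{u} n) (j : ℕ) {k : ℕ} (hjk : j ≤ k) :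
    ∀ hk : k ≤ n, C.cell j (hjk.trans hk) → C.cell k hk :=
  Nat.leRec (motive := fun k hjk => ∀ hk : k ≤ n, C.cell j (hjk.trans hk) → C.cell k hk)
    (fun _ x => x) (fun _ _ ih hk x => C.idt hk (ih (Nat.le_of_succ_le hk) x)) hjk

theorem CatData.idTo_self {n : ℕ} (C : CatData.{u} n) {k : ℕ} (h : k ≤ k) (hk : k ≤ n)
    (x : C.cell k hk) : C.idTo k h hk x = x := by
  unfold CatData.idTo; rw [Nat.leRec_self]

theorem CatData.idTo_succ {n : ℕ} (C : CatData.{u} n) {j k : ℕ} (h : j ≤ k + 1) (hjk : j ≤ k)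
    (hk : k + 1 ≤ n) (x : C.cell j (h.trans hk)) :
    C.idTo j h hk x = C.idt hk (C.idTo j hjk (Nat.le_of_succ_le hk) x) := by
  unfold CatData.idTo; rw [Nat.leRec_succ]

/-- A strict `n`-category. The equations quantify over all proofs of the composability
conditions occurring in them; those that are not assumptions of the usual axioms follow from
the other conditions together with the boundary laws (see the lemmas below). -/
structure StrCat (n : ℕ) extends CatData.{u} n where
  src_idt : ∀ {k : ℕ} (hk : k + 1 ≤ n) (x : cell k (Nat.le_of_succ_le hk)),
    src hk (idt hk x) = x
  tgt_idt : ∀ {k : ℕ} (hk : k + 1 ≤ n) (x : cell k (Nat.le_of_succ_le hk)),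
    tgt hk (idt hk x) = x
  src_comp_top : ∀ {k : ℕ} (hk : k + 1 ≤ n) (x y : cell (k + 1) hk) (h),
    src hk (comp hk k (Nat.lt_succ_self k) x y h) = src hk x
  tgt_comp_top : ∀ {k : ℕ} (hk : k + 1 ≤ n) (x y : cell (k + 1) hk) (h),
    tgt hk (comp hk k (Nat.lt_succ_self k) x y h) = tgt hk y
  src_comp : ∀ {k : ℕ} (hk : k + 1 ≤ n) (j : ℕ) (hj : j < k) (x y : cell (k + 1) hk) (h h'),
    src hk (comp hk j (Nat.lt_succ_of_lt hj) x y h) =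
      comp (Nat.le_of_succ_le hk) j hj (src hk x) (src hk y) h'
  tgt_comp : ∀ {k : ℕ} (hk : k + 1 ≤ n) (j : ℕ) (hj : j < k) (x y : cell (k + 1) hk) (h h'),
    tgt hk (comp hk j (Nat.lt_succ_of_lt hj) x y h) =
      comp (Nat.le_of_succ_le hk) j hj (tgt hk x) (tgt hk y) h'
  assoc : ∀ {k : ℕ} (hk : k ≤ n) (j : ℕ) (hj : j < k) (x y z : cell k hk) (h₁ h₂ h₃ h₄),
    comp hk j hj (comp hk j hj x y h₁) z h₂ = comp hk j hj x (comp hk j hj y z h₃) h₄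
  id_comp : ∀ {k : ℕ} (hk : k ≤ n) (j : ℕ) (hj : j < k) (x : cell k hk) (h),
    comp hk j hj (toCatData.idTo j hj.le hk (toGSet.srcTo j hj.le hk x)) x h = x
  comp_id : ∀ {k : ℕ} (hk : k ≤ n) (j : ℕ) (hj : j < k) (x : cell k hk) (h),
    comp hk j hj x (toCatData.idTo j hj.le hk (toGSet.tgtTo j hj.le hk x)) h = x
  interchange : ∀ {k : ℕ} (hk : k ≤ n) (i j : ℕ) (hi : i < k) (hj : j < k), i < j →
    ∀ (x y x' y' : cell k hk) (h₁ h₂ h₃ h₄ h₅ h₆),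
      comp hk i hi (comp hk j hj x y h₁) (comp hk j hj x' y' h₂) h₃ =
        comp hk j hj (comp hk i hi x x' h₄) (comp hk i hi y y' h₅) h₆
  idt_comp : ∀ {k : ℕ} (hk : k + 1 ≤ n) (j : ℕ) (hj : j < k)
    (x y : cell k (Nat.le_of_succ_le hk)) (h h'),
    comp hk j (Nat.lt_succ_of_lt hj) (idt hk x) (idt hk y) h' =
      idt hk (comp (Nat.le_of_succ_le hk) j hj x y h)

/-! The composability conditions in the equations of a strict `n`-category follow from those on
the cells that are being composed. -/

section sideConditions

variable {n : ℕ} {X : GSet.{u} n} (C : StrCat.{u} n)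

theorem GSet.tgtTo_tgtTo {i j k : ℕ} (hij : i ≤ j) (hjk : j ≤ k) (hk : k ≤ n) (x : X.cell k hk) :
    X.tgtTo i hij (hjk.trans hk) (X.tgtTo j hjk hk x) = X.tgtTo i (hij.trans hjk) hk x := by
  induction k, hjk using Nat.le_induction with
  | base => rw [GSet.tgtTo_self]
  | succ k h ih =>
    rw [X.tgtTo_succ _ h, X.tgtTo_succ _ (hij.trans h)]
    exact ih _ _

theorem GSet.tgtTo_srcTo {i j k : ℕ} (hij : i < j) (hjk : j ≤ k) (hk : k ≤ n) (x : X.cell k hk) :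
    X.tgtTo i hij.le (hjk.trans hk) (X.srcTo j hjk hk x) = X.tgtTo i (hij.le.trans hjk) hk x := by
  induction k, hjk using Nat.le_induction with
  | base => rw [GSet.srcTo_self]
  | succ k h ih =>
    rw [X.srcTo_succ _ h]
    refine (ih _ _).trans ?_
    exact X.tgtTo_src (lt_of_lt_of_le hij h) hk x

/-- Cells composable along dimension `j` have the same target in dimensions `i < j`. -/
theorem GSet.tgtTo_eq_of_composable {i j k : ℕ} (hij : i < j) (hjk : j ≤ k) (hk : k ≤ n)
    {x y : X.cell k hk} (h : X.tgtTo j hjk hk x = X.srcTo j hjk hk y) :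
    X.tgtTo i (hij.le.trans hjk) hk x = X.tgtTo i (hij.le.trans hjk) hk y := by
  rw [← X.tgtTo_tgtTo hij.le hjk, h, X.tgtTo_srcTo hij hjk]

/-- The condition in `id_comp`. -/
theorem StrCat.tgtTo_idTo {j k : ℕ} (hjk : j ≤ k) (hk : k ≤ n) (x : C.cell j (hjk.trans hk)) :
    C.tgtTo j hjk hk (C.idTo j hjk hk x) = x := by
  induction k, hjk using Nat.le_induction with
  | base => rw [GSet.tgtTo_self, CatData.idTo_self]
  | succ k h ih => rw [C.idTo_succ _ h, GSet.tgtTo_succ _ _ h, C.tgt_idt, ih]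

/-- The condition in `comp_id`. -/
theorem StrCat.srcTo_idTo {j k : ℕ} (hjk : j ≤ k) (hk : k ≤ n) (x : C.cell j (hjk.trans hk)) :
    C.srcTo j hjk hk (C.idTo j hjk hk x) = x := by
  induction k, hjk using Nat.le_induction with
  | base => rw [GSet.srcTo_self, CatData.idTo_self]
  | succ k h ih => rw [C.idTo_succ _ h, GSet.srcTo_succ _ _ h, C.src_idt, ih]

/-- Sources of composites in dimensions `i ≤ j`. -/
theorem StrCat.srcTo_comp_le {i j k : ℕ} (hij : i ≤ j) (hj : j < k) (hk : k ≤ n)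
    (x y : C.cell k hk) (h) :
    C.srcTo i (hij.trans hj.le) hk (C.comp hk j hj x y h) =
      C.srcTo i (hij.trans hj.le) hk x := by
  induction k, hj using Nat.le_induction with
  | base => rw [C.srcTo_succ _ hij, C.src_comp_top, ← C.srcTo_succ]
  | succ k hj' ih =>
    rw [C.srcTo_succ _ (hij.trans (Nat.le_of_succ_le hj')),
      C.src_comp hk j hj' x y h (GSet.composable_src hj' hk h)]
    refine (ih _ _ _ _).trans ?_
    rw [← C.srcTo_succ]

/-- Targets of composites in dimensions `i ≤ j`. -/
theorem StrCat.tgtTo_comp_le {i j k : ℕ} (hij : i ≤ j) (hj : j < k) (hk : k ≤ n)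
    (x y : C.cell k hk) (h) :
    C.tgtTo i (hij.trans hj.le) hk (C.comp hk j hj x y h) =
      C.tgtTo i (hij.trans hj.le) hk y := by
  induction k, hj using Nat.le_induction with
  | base => rw [C.tgtTo_succ _ hij, C.tgt_comp_top, ← C.tgtTo_succ]
  | succ k hj' ih =>
    rw [C.tgtTo_succ _ (hij.trans (Nat.le_of_succ_le hj')),
      C.tgt_comp hk j hj' x y h (GSet.composable_tgt hj' hk h)]
    refine (ih _ _ _ _).trans ?_
    rw [← C.tgtTo_succ]

/-- Iterated sources and targets of a composite along dimension `i`, in a dimension `j > i`, are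
composites; in particular a composite pair has composable boundaries. -/
theorem StrCat.composable_comp {i j k : ℕ} (hij : i < j) (hjk : j ≤ k) (hk : k ≤ n)
    (x y x' y' : C.cell k hk) (h₁ : C.tgtTo j hjk hk x = C.srcTo j hjk hk y)
    (h₂ : C.tgtTo j hjk hk x' = C.srcTo j hjk hk y') (h₄) (h₅) :
    C.tgtTo j hjk hk (C.comp hk i (hij.trans_le hjk) x x' h₄) =
      C.srcTo j hjk hk (C.comp hk i (hij.trans_le hjk) y y' h₅) := by
  have ht : ∀ {k : ℕ} (hjk : j ≤ k) (hk : k ≤ n) (x x' : C.cell k hk) (h), ∃ h',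
      C.tgtTo j hjk hk (C.comp hk i (hij.trans_le hjk) x x' h) =
        C.comp (hjk.trans hk) i hij (C.tgtTo j hjk hk x) (C.tgtTo j hjk hk x') h' := by
    intro k hjk
    induction k, hjk using Nat.le_induction with
    | base => intro hk x x' h; simp only [GSet.tgtTo_self]; exact ⟨h, trivial⟩
    | succ k hjk ih =>
      intro hk x x' h
      obtain ⟨h', e⟩ := ih (Nat.le_of_succ_le hk) _ _
        (GSet.composable_tgt (hij.trans_le hjk) hk h)
      simp only [C.tgtTo_succ _ hjk]
      exact ⟨h', by rw [← e, ← C.tgt_comp]⟩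
  have hs : ∀ {k : ℕ} (hjk : j ≤ k) (hk : k ≤ n) (x x' : C.cell k hk) (h), ∃ h',
      C.srcTo j hjk hk (C.comp hk i (hij.trans_le hjk) x x' h) =
        C.comp (hjk.trans hk) i hij (C.srcTo j hjk hk x) (C.srcTo j hjk hk x') h' := by
    intro k hjk
    induction k, hjk using Nat.le_induction with
    | base => intro hk x x' h; simp only [GSet.srcTo_self]; exact ⟨h, trivial⟩
    | succ k hjk ih =>
      intro hk x x' h
      obtain ⟨h', e⟩ := ih (Nat.le_of_succ_le hk) _ _
        (GSet.composable_src (hij.trans_le hjk) hk h)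
      simp only [C.srcTo_succ _ hjk]
      exact ⟨h', by rw [← e, ← C.src_comp]⟩
  obtain ⟨_, e₁⟩ := ht hjk hk x x' h₄
  obtain ⟨_, e₂⟩ := hs hjk hk y y' h₅
  rw [e₁, e₂]
  simp only [h₁, h₂]

/-- The derived conditions in `interchange`. -/
theorem StrCat.interchange_conditions {i j k : ℕ} (hij : i < j) (hj : j < k) (hk : k ≤ n)
    (x y x' y' : C.cell k hk) (h₁) (h₂)
    (h₄ : C.tgtTo i (hij.trans hj).le hk x = C.srcTo i (hij.trans hj).le hk x')
    (h₅ : C.tgtTo i (hij.trans hj).le hk y = C.srcTo i (hij.trans hj).le hk y') :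
    C.tgtTo i (hij.trans hj).le hk (C.comp hk j hj x y h₁) =
      C.srcTo i (hij.trans hj).le hk (C.comp hk j hj x' y' h₂) ∧
    C.tgtTo j hj.le hk (C.comp hk i (hij.trans hj) x x' h₄) =
      C.srcTo j hj.le hk (C.comp hk i (hij.trans hj) y y' h₅) := by
  refine ⟨?_, C.composable_comp hij hj.le hk x y x' y' h₁ h₂ h₄ h₅⟩
  have e₁ := C.tgtTo_comp_le hij.le hj hk x y h₁
  have e₂ := C.srcTo_comp_le hij.le hj hk x' y' h₂
  rw [e₁, e₂, ← h₄]
  exact (GSet.tgtTo_eq_of_composable hij hj.le hk h₁).symm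

end sideConditions

/-- A strict `n`-functor. -/
@[ext]
structure StrCat.Hom {n : ℕ} (C D : StrCat.{u} n) extends GSet.Hom C.toGSet D.toGSet where
  app_idt : ∀ {k : ℕ} (hk : k + 1 ≤ n) (x : C.cell k (Nat.le_of_succ_le hk)),
    app hk (C.idt hk x) = D.idt hk (app (Nat.le_of_succ_le hk) x)
  app_comp : ∀ {k : ℕ} (hk : k ≤ n) (j : ℕ) (hj : j < k) (x y : C.cell k hk) (h h'),
    app hk (C.comp hk j hj x y h) = D.comp hk j hj (app hk x) (app hk y) h'

theorem StrCat.Hom.composable {n : ℕ} {C D : StrCat.{u} n} (f : GSet.Hom C.toGSet D.toGSet)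
    {k : ℕ} (hk : k ≤ n) (j : ℕ) (hj : j < k) (x y : C.cell k hk)
    (h : C.tgtTo j hj.le hk x = C.srcTo j hj.le hk y) :
    D.tgtTo j hj.le hk (f.app hk x) = D.srcTo j hj.le hk (f.app hk y) := by
  rw [← f.app_tgtTo, ← f.app_srcTo, h]

/-- The category of strict `n`-categories and strict `n`-functors. -/
instance StrCat.category (n : ℕ) : Category.{u} (StrCat.{u} n) where
  Hom := StrCat.Hom
  id C :=
    { toHom := GSet.Hom.id C.toGSet
      app_idt := fun _ _ => rfl
      app_comp := fun _ _ _ _ _ _ _ => rfl }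
  comp {C D E} f g :=
    { toHom := f.toHom.comp g.toHom
      app_idt := fun hk x => by
        change g.app hk (f.app hk _) = E.idt hk (g.app _ (f.app _ x))
        rw [f.app_idt, g.app_idt]
      app_comp := fun hk j hj x y h h' => by
        change g.app hk (f.app hk _) = E.comp hk j hj (g.app hk (f.app hk x)) _ h'
        rw [f.app_comp hk j hj x y h (StrCat.Hom.composable f.toHom hk j hj x y h)]
        exact g.app_comp hk j hj _ _ _ _ }

/-- The forgetful functor from strict `n`-categories to `n`-globular sets. -/
def forgetful (n : ℕ) : StrCat.{u} n ⥤ GSet.{u} n where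
  obj C := C.toGSet
  map {C D} f := StrCat.Hom.toHom (C := C) (D := D) f

/-! ## The free strict `n`-category

Formal composites of cells of `X`, taken modulo equality of their values in all strict
`n`-categories; only those composites are kept whose value is always defined. -/

/-- Formal (not necessarily composable) `k`-dimensional composites of cells of `X`. -/
inductive Term {n : ℕ} (X : GSet.{u} n) : ℕ → Type u
  | gen {k : ℕ} (hk : k ≤ n) (x : X.cell k hk) : Term X k
  | idt {k : ℕ} (p : Term X k) : Term X (k + 1)
  | comp {k : ℕ} (j : ℕ) (hj : j < k) (p q : Term X k) : Term X k

/-- `Eval f hk p a`: the term `p` is defined in `C` under the labelling `f`, with value `a`. -/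
inductive Eval {n : ℕ} {X : GSet.{u} n} {C : StrCat.{u} n} (f : X ⟶ C.toGSet) :
    ∀ {k : ℕ} (hk : k ≤ n), Term X k → C.cell k hk → Prop
  | gen {k : ℕ} (hk : k ≤ n) (x : X.cell k hk) : Eval f hk (Term.gen hk x) (f.app hk x)
  | idt {k : ℕ} (hk : k + 1 ≤ n) (p : Term X k) (a : C.cell k (Nat.le_of_succ_le hk)) :
      Eval f (Nat.le_of_succ_le hk) p a → Eval f hk (Term.idt p) (C.idt hk a)
  | comp {k : ℕ} (hk : k ≤ n) (j : ℕ) (hj : j < k) (p q : Term X k) (a b : C.cell k hk)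
      (h : C.tgtTo j hj.le hk a = C.srcTo j hj.le hk b) :
      Eval f hk p a → Eval f hk q b → Eval f hk (Term.comp j hj p q) (C.comp hk j hj a b h)

section free

variable {n : ℕ} {X : GSet.{u} n}

theorem Eval.det {C : StrCat.{u} n} {f : X ⟶ C.toGSet} {k : ℕ} {hk : k ≤ n} {p : Term X k}
    {a b : C.cell k hk} (ha : Eval f hk p a) (hb : Eval f hk p b) : a = b := by
  induction ha with
  | gen hk x => cases hb; rfl
  | idt hk p a _ ih => cases hb with | idt _ _ b hb => rw [ih hb]
  | comp hk j hj p q a b h _ _ ih₁ ih₂ =>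
    cases hb with
    | comp _ _ _ _ _ a' b' h' h₁ h₂ =>
      obtain rfl := ih₁ h₁
      obtain rfl := ih₂ h₂
      rfl

/-- The source of a term. -/
def Term.src : ∀ {k : ℕ}, Term X (k + 1) → Term X k
  | _, .gen hk x => .gen (Nat.le_of_succ_le hk) (X.src hk x)
  | _, .idt p => p
  | k, .comp j _ p q => if h : j < k then .comp j h p.src q.src else p.src

/-- The target of a term. -/
def Term.tgt : ∀ {k : ℕ}, Term X (k + 1) → Term X k
  | _, .gen hk x => .gen (Nat.le_of_succ_le hk) (X.tgt hk x)
  | _, .idt p => p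
  | k, .comp j _ p q => if h : j < k then .comp j h p.tgt q.tgt else q.tgt

theorem Term.src_gen {k : ℕ} (hk : k + 1 ≤ n) (x : X.cell (k + 1) hk) :
    (Term.gen hk x).src = .gen (Nat.le_of_succ_le hk) (X.src hk x) := by rw [Term.src]

theorem Term.tgt_gen {k : ℕ} (hk : k + 1 ≤ n) (x : X.cell (k + 1) hk) :
    (Term.gen hk x).tgt = .gen (Nat.le_of_succ_le hk) (X.tgt hk x) := by rw [Term.tgt]

theorem Term.src_idt {k : ℕ} (p : Term X k) : (Term.idt p).src = p := by rw [Term.src]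

theorem Term.tgt_idt {k : ℕ} (p : Term X k) : (Term.idt p).tgt = p := by rw [Term.tgt]

theorem Term.src_comp_lt {j k : ℕ} (h : j < k) (hj : j < k + 1) (p q : Term X (k + 1)) :
    (Term.comp j hj p q).src = .comp j h p.src q.src := by
  rw [Term.src, dif_pos h]

theorem Term.src_comp_top {k : ℕ} (hj : k < k + 1) (p q : Term X (k + 1)) :
    (Term.comp k hj p q).src = p.src := by
  rw [Term.src, dif_neg (lt_irrefl k)]

theorem Term.tgt_comp_lt {j k : ℕ} (h : j < k) (hj : j < k + 1) (p q : Term X (k + 1)) :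
    (Term.comp j hj p q).tgt = .comp j h p.tgt q.tgt := by
  rw [Term.tgt, dif_pos h]

theorem Term.tgt_comp_top {k : ℕ} (hj : k < k + 1) (p q : Term X (k + 1)) :
    (Term.comp k hj p q).tgt = q.tgt := by
  rw [Term.tgt, dif_neg (lt_irrefl k)]

theorem Eval.src_aux {C : StrCat.{u} n} {f : X ⟶ C.toGSet} {m : ℕ} {hm : m ≤ n}
    {p : Term X m} {a : C.cell m hm} (h : Eval f hm p a) :
    ∀ (k : ℕ) (e : m = k + 1), Eval f (Nat.le_of_succ_le (e ▸ hm)) (Term.src (e ▸ p))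
      (C.src (e ▸ hm) (by subst e; exact a)) := by
  intro k hm
  induction h with
  | gen _ x =>
    subst hm
    rw [Term.src, ← f.app_src]; exact .gen _ _
  | idt _ p a h =>
    obtain rfl := Nat.succ.inj hm
    rw [Term.src, C.src_idt]; exact h
  | comp _ j hj p q a b h _ _ hp hq =>
    subst hm
    by_cases hlt : j < k
    · rw [Term.src_comp_lt hlt, C.src_comp _ j hlt a b h (GSet.composable_src hlt _ h)]
      exact .comp _ j hlt _ _ _ _ _ (hp rfl) (hq rfl)
    · obtain rfl : j = k := by omega
      rw [Term.src_comp_top, C.src_comp_top]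
      exact hp rfl

theorem Eval.src {C : StrCat.{u} n} {f : X ⟶ C.toGSet} {k : ℕ} {hk : k + 1 ≤ n}
    {p : Term X (k + 1)} {a : C.cell (k + 1) hk} (h : Eval f hk p a) :
    Eval f (Nat.le_of_succ_le hk) p.src (C.src hk a) := h.src_aux k rfl

theorem Eval.tgt_aux {C : StrCat.{u} n} {f : X ⟶ C.toGSet} {m : ℕ} {hm : m ≤ n}
    {p : Term X m} {a : C.cell m hm} (h : Eval f hm p a) :
    ∀ (k : ℕ) (e : m = k + 1), Eval f (Nat.le_of_succ_le (e ▸ hm)) (Term.tgt (e ▸ p))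
      (C.tgt (e ▸ hm) (by subst e; exact a)) := by
  intro k hm
  induction h with
  | gen _ x =>
    subst hm
    rw [Term.tgt, ← f.app_tgt]; exact .gen _ _
  | idt _ p a h =>
    obtain rfl := Nat.succ.inj hm
    rw [Term.tgt, C.tgt_idt]; exact h
  | comp _ j hj p q a b h _ _ hp hq =>
    subst hm
    by_cases hlt : j < k
    · rw [Term.tgt_comp_lt hlt, C.tgt_comp _ j hlt a b h (GSet.composable_tgt hlt _ h)]
      exact .comp _ j hlt _ _ _ _ _ (hp rfl) (hq rfl)
    · obtain rfl : j = k := by omega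
      rw [Term.tgt_comp_top, C.tgt_comp_top]
      exact hq rfl

theorem Eval.tgt {C : StrCat.{u} n} {f : X ⟶ C.toGSet} {k : ℕ} {hk : k + 1 ≤ n}
    {p : Term X (k + 1)} {a : C.cell (k + 1) hk} (h : Eval f hk p a) :
    Eval f (Nat.le_of_succ_le hk) p.tgt (C.tgt hk a) := h.tgt_aux k rfl

/-- A term is valid if it is defined under every labelling in every strict `n`-category. -/
def Term.Valid {k : ℕ} (hk : k ≤ n) (p : Term X k) : Prop :=
  ∀ (C : StrCat.{u} n) (f : X ⟶ C.toGSet), ∃ a, Eval f hk p a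

/-- Valid terms are identified if they always have the same value. -/
def termSetoid (X : GSet.{u} n) {k : ℕ} (hk : k ≤ n) : Setoid {p : Term X k // p.Valid hk} where
  r p q := ∀ (C : StrCat.{u} n) (f : X ⟶ C.toGSet), ∃ a, Eval f hk p.1 a ∧ Eval f hk q.1 a
  iseqv :=
    { refl := fun p C f => (p.2 C f).imp fun _ h => ⟨h, h⟩
      symm := fun h C f => (h C f).imp fun _ h => ⟨h.2, h.1⟩
      trans := fun h h' C f => by
        obtain ⟨a, ha, hb⟩ := h C f
        obtain ⟨b, hb', hc⟩ := h' C f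
        obtain rfl := hb.det hb'
        exact ⟨a, ha, hc⟩ }

/-- The `k`-cells of the free strict `n`-category on `X`. -/
def FreeCell (X : GSet.{u} n) (k : ℕ) (hk : k ≤ n) : Type u := Quotient (termSetoid X hk)

/-- The class of a valid term. -/
def FreeCell.mk {k : ℕ} (hk : k ≤ n) (p : Term X k) (hp : p.Valid hk) : FreeCell X k hk :=
  Quotient.mk (termSetoid X hk) ⟨p, hp⟩

/-- The value of a cell of the free strict `n`-category under a labelling. -/
noncomputable def FreeCell.ev {C : StrCat.{u} n} (f : X ⟶ C.toGSet) {k : ℕ} {hk : k ≤ n}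
    (x : FreeCell X k hk) : C.cell k hk :=
  Quotient.lift (s := termSetoid X hk) (fun p => (p.2 C f).choose) (fun p q h => by
    obtain ⟨a, ha, hb⟩ := h C f
    exact ((p.2 C f).choose_spec.det ha).trans (hb.det (q.2 C f).choose_spec)) x

theorem FreeCell.ev_spec {C : StrCat.{u} n} (f : X ⟶ C.toGSet) {k : ℕ} {hk : k ≤ n}
    {p : Term X k} (hp : p.Valid hk) : Eval f hk p (FreeCell.ev f (FreeCell.mk hk p hp)) :=
  (hp C f).choose_spec

theorem FreeCell.ev_mk {C : StrCat.{u} n} (f : X ⟶ C.toGSet) {k : ℕ} {hk : k ≤ n}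
    {p : Term X k} (hp : p.Valid hk) {a : C.cell k hk} (h : Eval f hk p a) :
    FreeCell.ev f (FreeCell.mk hk p hp) = a :=
  (FreeCell.ev_spec f hp).det h

theorem FreeCell.exists_rep {k : ℕ} {hk : k ≤ n} (x : FreeCell X k hk) :
    ∃ (p : Term X k) (hp : p.Valid hk), FreeCell.mk hk p hp = x := by
  obtain ⟨⟨p, hp⟩, rfl⟩ := Quotient.exists_rep x
  exact ⟨p, hp, rfl⟩

theorem FreeCell.ext {k : ℕ} {hk : k ≤ n} {x y : FreeCell X k hk}
    (h : ∀ (C : StrCat.{u} n) (f : X ⟶ C.toGSet), FreeCell.ev f x = FreeCell.ev f y) :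
    x = y := by
  obtain ⟨p, hp, rfl⟩ := x.exists_rep
  obtain ⟨q, hq, rfl⟩ := y.exists_rep
  refine Quotient.sound (s := termSetoid X hk) fun C f => ⟨_, FreeCell.ev_spec f hp, ?_⟩
  rw [h C f]
  exact FreeCell.ev_spec f hq

theorem Term.Valid.src {k : ℕ} {hk : k + 1 ≤ n} {p : Term X (k + 1)} (hp : p.Valid hk) :
    p.src.Valid (Nat.le_of_succ_le hk) := fun C f => ⟨_, (hp C f).choose_spec.src⟩

theorem Term.Valid.tgt {k : ℕ} {hk : k + 1 ≤ n} {p : Term X (k + 1)} (hp : p.Valid hk) :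
    p.tgt.Valid (Nat.le_of_succ_le hk) := fun C f => ⟨_, (hp C f).choose_spec.tgt⟩

/-- The underlying `n`-globular set of the free strict `n`-category. -/
def freeGSet (X : GSet.{u} n) : GSet.{u} n where
  cell := FreeCell X
  src hk x := Quotient.map' (s₁ := termSetoid X hk) (s₂ := termSetoid X (Nat.le_of_succ_le hk))
    (fun p => ⟨p.1.src, p.2.src⟩)
    (fun _ _ h C f => (h C f).elim fun _ h => ⟨_, h.1.src, h.2.src⟩) x
  tgt hk x := Quotient.map' (s₁ := termSetoid X hk) (s₂ := termSetoid X (Nat.le_of_succ_le hk))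
    (fun p => ⟨p.1.tgt, p.2.tgt⟩)
    (fun _ _ h C f => (h C f).elim fun _ h => ⟨_, h.1.tgt, h.2.tgt⟩) x
  src_src {k} hk x := by
    obtain ⟨p, hp, rfl⟩ := FreeCell.exists_rep x
    refine Quotient.sound (s := termSetoid X _) fun C f => ?_
    obtain ⟨a, ha⟩ := hp C f
    exact ⟨_, ha.src.src, by rw [C.src_src]; exact ha.tgt.src⟩
  tgt_src {k} hk x := by
    obtain ⟨p, hp, rfl⟩ := FreeCell.exists_rep x
    refine Quotient.sound (s := termSetoid X _) fun C f => ?_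
    obtain ⟨a, ha⟩ := hp C f
    exact ⟨_, ha.src.tgt, by rw [C.tgt_src]; exact ha.tgt.tgt⟩

/-- Evaluation as a morphism of `n`-globular sets. -/
noncomputable def evHom {C : StrCat.{u} n} (f : X ⟶ C.toGSet) :
    GSet.Hom (freeGSet X) C.toGSet where
  app _ x := FreeCell.ev f x
  app_src hk x := by
    obtain ⟨p, hp, rfl⟩ := FreeCell.exists_rep x
    exact FreeCell.ev_mk f hp.src (FreeCell.ev_spec f hp).src
  app_tgt hk x := by
    obtain ⟨p, hp, rfl⟩ := FreeCell.exists_rep x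
    exact FreeCell.ev_mk f hp.tgt (FreeCell.ev_spec f hp).tgt

theorem FreeCell.composable {C : StrCat.{u} n} (f : X ⟶ C.toGSet) {k : ℕ} {hk : k ≤ n} {j : ℕ}
    (hj : j < k) {x y : (freeGSet X).cell k hk}
    (h : (freeGSet X).tgtTo j hj.le hk x = (freeGSet X).srcTo j hj.le hk y) :
    C.tgtTo j hj.le hk ((evHom f).app hk x) = C.srcTo j hj.le hk ((evHom f).app hk y) := by
  have h₁ := (evHom f).app_tgtTo hj.le hk x
  have h₂ := (evHom f).app_srcTo hj.le hk y
  rw [h] at h₁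
  exact h₁.symm.trans h₂

theorem Term.Valid.gen {k : ℕ} (hk : k ≤ n) (x : X.cell k hk) : (Term.gen hk x).Valid hk :=
  fun _ _ => ⟨_, .gen _ _⟩

theorem Term.Valid.idt {k : ℕ} {hk : k + 1 ≤ n} {p : Term X k}
    (hp : p.Valid (Nat.le_of_succ_le hk)) : (Term.idt p).Valid hk :=
  fun C f => ⟨_, .idt _ _ _ (hp C f).choose_spec⟩

theorem Term.Valid.comp {k : ℕ} {hk : k ≤ n} {j : ℕ} {hj : j < k} {p q : Term X k}
    (hp : p.Valid hk) (hq : q.Valid hk)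
    (h : (freeGSet X).tgtTo j hj.le hk (FreeCell.mk hk p hp) =
      (freeGSet X).srcTo j hj.le hk (FreeCell.mk hk q hq)) : (Term.comp j hj p q).Valid hk :=
  fun _ f => ⟨_, .comp _ _ _ _ _ _ _ (FreeCell.composable f hj h) (FreeCell.ev_spec f hp)
    (FreeCell.ev_spec f hq)⟩

/-- The identities and compositions of the free strict `n`-category. -/
noncomputable def freeData (X : GSet.{u} n) : CatData.{u} n where
  toGSet := freeGSet X
  idt {k} hk x := Quotient.map' (s₁ := termSetoid X (Nat.le_of_succ_le hk)) (s₂ := termSetoid X hk)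
    (fun p => ⟨p.1.idt, p.2.idt⟩)
    (fun _ _ h C f => (h C f).elim fun _ h => ⟨_, .idt _ _ _ h.1, .idt _ _ _ h.2⟩) x
  comp hk j hj x y h :=
    FreeCell.mk hk
      (.comp j hj (FreeCell.exists_rep x).choose (FreeCell.exists_rep y).choose)
      (.comp (FreeCell.exists_rep x).choose_spec.choose (FreeCell.exists_rep y).choose_spec.choose
        (by
          rw [(FreeCell.exists_rep x).choose_spec.choose_spec,
            (FreeCell.exists_rep y).choose_spec.choose_spec]
          exact h))

/-- Evaluation on the free strict `n`-category. -/
noncomputable def ev {C : StrCat.{u} n} (f : X ⟶ C.toGSet) :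
    GSet.Hom (freeData X).toGSet C.toGSet := evHom f

theorem free_ext {k : ℕ} {hk : k ≤ n} {x y : (freeData X).cell k hk}
    (h : ∀ (C : StrCat.{u} n) (f : X ⟶ C.toGSet), (ev f).app hk x = (ev f).app hk y) :
    x = y := FreeCell.ext h

theorem ev_composable {C : StrCat.{u} n} (f : X ⟶ C.toGSet) {k : ℕ} {hk : k ≤ n} {j : ℕ}
    (hj : j < k) {x y : (freeData X).cell k hk}
    (h : (freeData X).tgtTo j hj.le hk x = (freeData X).srcTo j hj.le hk y) :
    C.tgtTo j hj.le hk ((ev f).app hk x) = C.srcTo j hj.le hk ((ev f).app hk y) :=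
  FreeCell.composable f hj h

theorem ev_idt {C : StrCat.{u} n} (f : X ⟶ C.toGSet) {k : ℕ} (hk : k + 1 ≤ n)
    (x : (freeData X).cell k (Nat.le_of_succ_le hk)) :
    (ev f).app hk ((freeData X).idt hk x) = C.idt hk ((ev f).app _ x) := by
  obtain ⟨p, hp, rfl⟩ := FreeCell.exists_rep x
  exact FreeCell.ev_mk f hp.idt (.idt _ _ _ (FreeCell.ev_spec f hp))

theorem ev_idTo {C : StrCat.{u} n} (f : X ⟶ C.toGSet) {j k : ℕ} (hjk : j ≤ k) (hk : k ≤ n)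
    (x : (freeData X).cell j (hjk.trans hk)) :
    (ev f).app hk ((freeData X).idTo j hjk hk x) = C.idTo j hjk hk ((ev f).app _ x) := by
  induction k, hjk using Nat.le_induction with
  | base => rw [CatData.idTo_self, CatData.idTo_self]
  | succ k h ih => rw [CatData.idTo_succ _ _ h, CatData.idTo_succ _ _ h, ev_idt, ih]

theorem ev_comp {C : StrCat.{u} n} (f : X ⟶ C.toGSet) {k : ℕ} (hk : k ≤ n) (j : ℕ) (hj : j < k)
    (x y : (freeData X).cell k hk) (h) :
    (ev f).app hk ((freeData X).comp hk j hj x y h) =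
      C.comp hk j hj ((ev f).app hk x) ((ev f).app hk y) (ev_composable f hj h) := by
  have hx := (FreeCell.exists_rep x).choose_spec
  have hy := (FreeCell.exists_rep y).choose_spec
  apply FreeCell.ev_mk
  apply Eval.comp
  · have := FreeCell.ev_spec f hx.choose
    rwa [hx.choose_spec] at this
  · have := FreeCell.ev_spec f hy.choose
    rwa [hy.choose_spec] at this

/-- The free strict `n`-category on an `n`-globular set. -/
noncomputable def freeObj (X : GSet.{u} n) : StrCat.{u} n where
  toCatData := freeData X
  src_idt hk x := free_ext fun C f => by rw [(ev f).app_src, ev_idt, C.src_idt]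
  tgt_idt hk x := free_ext fun C f => by rw [(ev f).app_tgt, ev_idt, C.tgt_idt]
  src_comp_top hk x y h := free_ext fun C f => by
    rw [(ev f).app_src, ev_comp, C.src_comp_top, (ev f).app_src]
  tgt_comp_top hk x y h := free_ext fun C f => by
    rw [(ev f).app_tgt, ev_comp, C.tgt_comp_top, (ev f).app_tgt]
  src_comp hk j hj x y h h' := free_ext fun C f => by
    simp only [(ev f).app_src, ev_comp]
    exact C.src_comp hk j hj _ _ _ _
  tgt_comp hk j hj x y h h' := free_ext fun C f => by
    simp only [(ev f).app_tgt, ev_comp]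
    exact C.tgt_comp hk j hj _ _ _ _
  assoc hk j hj x y z h₁ h₂ h₃ h₄ := free_ext fun C f => by
    simp only [ev_comp]
    exact C.assoc hk j hj _ _ _ _ _ _ _
  id_comp hk j hj x h := free_ext fun C f => by
    simp only [ev_comp, ev_idTo, (ev f).app_srcTo]
    exact C.id_comp hk j hj _ _
  comp_id hk j hj x h := free_ext fun C f => by
    simp only [ev_comp, ev_idTo, (ev f).app_tgtTo]
    exact C.comp_id hk j hj _ _
  interchange hk i j hi hj hij x y x' y' h₁ h₂ h₃ h₄ h₅ h₆ := free_ext fun C f => by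
    simp only [ev_comp]
    exact C.interchange hk i j hi hj hij _ _ _ _ _ _ _ _ _ _
  idt_comp hk j hj x y h h' := free_ext fun C f => by
    simp only [ev_comp, ev_idt]
    exact C.idt_comp hk j hj _ _ _ _

/-- The inclusion of generators. -/
def freeIncl (X : GSet.{u} n) : X ⟶ (freeObj X).toGSet where
  app hk x := FreeCell.mk hk (Term.gen hk x) (Term.Valid.gen hk x)
  app_src {k} hk x := by
    change FreeCell.mk _ _ _ = FreeCell.mk _ (Term.src (Term.gen hk x)) _
    congr 1
    rw [Term.src]
  app_tgt {k} hk x := by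
    change FreeCell.mk _ _ _ = FreeCell.mk _ (Term.tgt (Term.gen hk x)) _
    congr 1
    rw [Term.tgt]

theorem ev_incl {C : StrCat.{u} n} (f : X ⟶ C.toGSet) {k : ℕ} (hk : k ≤ n) (x : X.cell k hk) :
    (ev f).app hk ((freeIncl X).app hk x) = f.app hk x :=
  FreeCell.ev_mk f (Term.Valid.gen hk x) (Eval.gen hk x)

/-- Every cell of the free strict `n`-category is built from generators by identities and
compositions. -/
theorem free_induction {P : ∀ {k : ℕ} (hk : k ≤ n), (freeObj X).cell k hk → Prop}
    (gen : ∀ {k : ℕ} (hk : k ≤ n) (x : X.cell k hk), P hk ((freeIncl X).app hk x))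
    (idt : ∀ {k : ℕ} (hk : k + 1 ≤ n) (x : (freeObj X).cell k (Nat.le_of_succ_le hk)),
      P (Nat.le_of_succ_le hk) x → P hk ((freeObj X).idt hk x))
    (comp : ∀ {k : ℕ} (hk : k ≤ n) (j : ℕ) (hj : j < k) (x y : (freeObj X).cell k hk) (h),
      P hk x → P hk y → P hk ((freeObj X).comp hk j hj x y h))
    {k : ℕ} (hk : k ≤ n) (x : (freeObj X).cell k hk) : P hk x := by
  obtain ⟨p, hp, rfl⟩ := FreeCell.exists_rep x
  induction p with
  | gen _ x => exact gen hk x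
  | @idt k p ih =>
    have hv : p.Valid (Nat.le_of_succ_le hk) := fun C f => by
      obtain ⟨a, ha⟩ := hp C f
      cases ha with | idt _ _ b hb => exact ⟨b, hb⟩
    exact idt hk _ (ih (Nat.le_of_succ_le hk) hv)
  | comp j hj p q ih₁ ih₂ =>
    have hp' : p.Valid hk := fun C f => by
      obtain ⟨a, ha⟩ := hp C f
      cases ha with | comp _ _ _ _ _ a b h h₁ h₂ => exact ⟨a, h₁⟩
    have hq' : q.Valid hk := fun C f => by
      obtain ⟨a, ha⟩ := hp C f
      cases ha with | comp _ _ _ _ _ a b h h₁ h₂ => exact ⟨b, h₂⟩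
    have h : (freeGSet X).tgtTo j hj.le hk (FreeCell.mk hk p hp') =
        (freeGSet X).srcTo j hj.le hk (FreeCell.mk hk q hq') := FreeCell.ext fun C f => by
      refine ((evHom f).app_tgtTo hj.le hk _).trans
        (Eq.trans ?_ ((evHom f).app_srcTo hj.le hk _).symm)
      obtain ⟨a, ha⟩ := hp C f
      cases ha with
      | comp _ _ _ _ _ a b h h₁ h₂ =>
        have e₁ : (evHom f).app hk (FreeCell.mk hk p hp') = a := FreeCell.ev_mk f hp' h₁
        have e₂ : (evHom f).app hk (FreeCell.mk hk q hq') = b := FreeCell.ev_mk f hq' h₂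
        rwa [e₁, e₂]
    have key := comp hk j hj _ _ h (ih₁ hk hp') (ih₂ hk hq')
    have e : (freeObj X).comp hk j hj (FreeCell.mk hk p hp') (FreeCell.mk hk q hq') h =
        FreeCell.mk hk (.comp j hj p q) hp := FreeCell.ext fun C f => by
      refine (ev_comp f hk j hj _ _ h).trans (FreeCell.ev_mk f hp ?_).symm
      exact .comp _ _ _ _ _ _ _ _ (FreeCell.ev_spec f hp') (FreeCell.ev_spec f hq')
    rwa [e] at key

/-- The strict `n`-functor out of the free strict `n`-category induced by a labelling. -/
noncomputable def freeLift {C : StrCat.{u} n} (f : X ⟶ C.toGSet) : freeObj X ⟶ C where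
  toHom := ev f
  app_idt hk x := ev_idt f hk x
  app_comp hk j hj x y h _ := ev_comp f hk j hj x y h

theorem StrCat.hom_ext_app {C D : StrCat.{u} n} {F G : C ⟶ D}
    (h : ∀ {k : ℕ} (hk : k ≤ n) (x : C.cell k hk), F.app hk x = G.app hk x) : F = G := by
  apply StrCat.Hom.ext
  funext k hk x
  exact h hk x

theorem free_hom_ext {C : StrCat.{u} n} {F G : freeObj X ⟶ C}
    (h : ∀ {k : ℕ} (hk : k ≤ n) (x : X.cell k hk),
      F.app hk ((freeIncl X).app hk x) = G.app hk ((freeIncl X).app hk x)) : F = G := by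
  apply StrCat.hom_ext_app
  intro k hk x
  refine free_induction (P := fun hk x => F.app hk x = G.app hk x) h ?_ ?_ hk x
  · intro k hk x ih
    rw [F.app_idt, G.app_idt, ih]
  · intro k hk j hj x y h ihx ihy
    rw [F.app_comp hk j hj x y h (StrCat.Hom.composable F.toHom hk j hj x y h),
      G.app_comp hk j hj x y h (StrCat.Hom.composable G.toHom hk j hj x y h)]
    simp only [ihx, ihy]

/-- The universal property of the free strict `n`-category. -/
noncomputable def freeEquiv (X : GSet.{u} n) (C : StrCat.{u} n) :
    (freeObj X ⟶ C) ≃ (X ⟶ (forgetful n).obj C) where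
  toFun F := freeIncl X ≫ (forgetful n).map F
  invFun f := freeLift f
  left_inv _ := free_hom_ext fun hk x => ev_incl _ hk x
  right_inv f := GSet.hom_ext fun _ hk x => ev_incl f hk x

end free

/-- The free strict `n`-category functor. -/
noncomputable def free (n : ℕ) : GSet.{u} n ⥤ StrCat.{u} n :=
  Adjunction.leftAdjointOfEquiv (G := forgetful n) freeEquiv (fun _ _ _ _ _ => rfl)

/-- The free strict `n`-category functor is left adjoint to the forgetful functor. -/
noncomputable def freeAdj (n : ℕ) : free.{u} n ⊣ forgetful n :=
  Adjunction.adjunctionOfEquivLeft freeEquiv (fun _ _ _ _ _ => rfl)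

/-- The free strict `n`-category monad `(-)^*`. -/
noncomputable def T (n : ℕ) : Monad (GSet.{u} n) := (freeAdj n).toMonad

/-! ## Collections and operads -/

/-- The terminal `n`-globular set `1`. -/
def GSet.one (n : ℕ) : GSet.{u} n where
  cell _ _ := PUnit
  src _ _ := PUnit.unit
  tgt _ _ := PUnit.unit
  src_src _ _ := rfl
  tgt_src _ _ := rfl

/-- The unique morphism to the terminal `n`-globular set. -/
def GSet.bang {n : ℕ} (X : GSet.{u} n) : X ⟶ GSet.one n where
  app _ _ := PUnit.unit
  app_src _ _ := rfl
  app_tgt _ _ := rfl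

theorem GSet.hom_one_ext {n : ℕ} {X : GSet.{u} n} (f g : X ⟶ GSet.one n) : f = g :=
  GSet.hom_ext fun _ _ _ => rfl

/-- The `n`-globular set `1^*` of shapes of pasting diagrams. -/
noncomputable abbrev shapes (n : ℕ) : GSet.{u} n := (T n).obj (GSet.one n)

/-- The boundary `∂τ` of a cell of `1^*`, namely its source. -/
noncomputable def bdry {n k : ℕ} (hk : k + 1 ≤ n) (τ : (shapes.{u} n).cell (k + 1) hk) :
    (shapes.{u} n).cell k (Nat.le_of_succ_le hk) := (shapes n).src hk τ

/-- The source and the target of a cell of `1^*` are equal. -/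
theorem bdry_eq_tgt {n k : ℕ} (hk : k + 1 ≤ n) (τ : (shapes.{u} n).cell (k + 1) hk) :
    bdry hk τ = (shapes n).tgt hk τ := by
  have key : ∀ {m : ℕ} (hm : m ≤ n) (x : (freeObj (GSet.one.{u} n)).cell m hm),
      ∀ (k : ℕ) (e : m = k + 1),
        (freeObj (GSet.one n)).src (e ▸ hm) (by subst e; exact x) =
          (freeObj (GSet.one n)).tgt (e ▸ hm) (by subst e; exact x) := by
    intro m hm x
    refine free_induction (P := fun {m} hm x => ∀ (k : ℕ) (e : m = k + 1),
        (freeObj (GSet.one n)).src (e ▸ hm) (by subst e; exact x) =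
          (freeObj (GSet.one n)).tgt (e ▸ hm) (by subst e; exact x)) ?_ ?_ ?_ hm x
    · rintro m hm x k rfl
      exact ((freeIncl (GSet.one n)).app_src _ x).symm.trans ((freeIncl (GSet.one n)).app_tgt _ x)
    · intro m hm x _ k e
      obtain rfl := Nat.succ.inj e
      exact ((freeObj _).src_idt _ x).trans ((freeObj _).tgt_idt _ x).symm
    · rintro m hm j hj x y h ihx ihy k rfl
      have hx := ihx k rfl
      have hy := ihy k rfl
      by_cases hlt : j < k
      · refine ((freeObj _).src_comp _ j hlt x y h (GSet.composable_src hlt _ h)).trans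
          (Eq.trans ?_ ((freeObj _).tgt_comp _ j hlt x y h (GSet.composable_tgt hlt _ h)).symm)
        congr 1
      · obtain rfl : j = k := by omega
        refine ((freeObj _).src_comp_top _ x y h).trans
          (Eq.trans ?_ ((freeObj _).tgt_comp_top _ x y h).symm)
        rw [GSet.tgtTo_succ _ _ le_rfl, GSet.srcTo_succ _ _ le_rfl, GSet.tgtTo_self,
          GSet.srcTo_self] at h
        exact hx.trans (h.trans hy)
  exact key hk τ k rfl

section pullback

variable {n : ℕ} {A B C : GSet.{u} n}

/-- The pullback of `f` and `g`, computed dimensionwise. -/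
def pb (f : A ⟶ C) (g : B ⟶ C) : GSet.{u} n where
  cell k hk := {z : A.cell k hk × B.cell k hk // f.app hk z.1 = g.app hk z.2}
  src hk z := ⟨(A.src hk z.1.1, B.src hk z.1.2), by rw [f.app_src, g.app_src, z.2]⟩
  tgt hk z := ⟨(A.tgt hk z.1.1, B.tgt hk z.1.2), by rw [f.app_tgt, g.app_tgt, z.2]⟩
  src_src hk z := Subtype.ext (Prod.ext (A.src_src hk _) (B.src_src hk _))
  tgt_src hk z := Subtype.ext (Prod.ext (A.tgt_src hk _) (B.tgt_src hk _))

/-- The first projection. -/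
def pb.fst (f : A ⟶ C) (g : B ⟶ C) : pb f g ⟶ A where
  app _ z := z.1.1
  app_src _ _ := rfl
  app_tgt _ _ := rfl

/-- The second projection. -/
def pb.snd (f : A ⟶ C) (g : B ⟶ C) : pb f g ⟶ B where
  app _ z := z.1.2
  app_src _ _ := rfl
  app_tgt _ _ := rfl

variable {f : A ⟶ C} {g : B ⟶ C}

theorem pb.condition : pb.fst f g ≫ f = pb.snd f g ≫ g := GSet.hom_ext fun _ _ z => z.2

/-- The morphism into the pullback induced by its universal property. -/
def pb.lift {W : GSet.{u} n} (a : W ⟶ A) (b : W ⟶ B) (w : a ≫ f = b ≫ g) : W ⟶ pb f g where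
  app hk x := ⟨(a.app hk x, b.app hk x), congrArg (fun h : W ⟶ C => GSet.Hom.app h hk x) w⟩
  app_src hk x := Subtype.ext (Prod.ext (a.app_src hk x) (b.app_src hk x))
  app_tgt hk x := Subtype.ext (Prod.ext (a.app_tgt hk x) (b.app_tgt hk x))

theorem pb.lift_fst_comp {W D : GSet.{u} n} (a : W ⟶ A) (b : W ⟶ B) (w : a ≫ f = b ≫ g)
    (c : A ⟶ D) : pb.lift a b w ≫ pb.fst f g ≫ c = a ≫ c := rfl

theorem pb.lift_fst {W : GSet.{u} n} (a : W ⟶ A) (b : W ⟶ B) (w : a ≫ f = b ≫ g) :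
    pb.lift a b w ≫ pb.fst f g = a := rfl

theorem pb.lift_snd {W : GSet.{u} n} (a : W ⟶ A) (b : W ⟶ B) (w : a ≫ f = b ≫ g) :
    pb.lift a b w ≫ pb.snd f g = b := rfl

theorem pb.hom_ext {W : GSet.{u} n} {a b : W ⟶ pb f g} (h₁ : a ≫ pb.fst f g = b ≫ pb.fst f g)
    (h₂ : a ≫ pb.snd f g = b ≫ pb.snd f g) : a = b :=
  GSet.hom_ext fun _ hk x => Subtype.ext (Prod.ext
    (congrArg (fun h : W ⟶ A => GSet.Hom.app h hk x) h₁)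
    (congrArg (fun h : W ⟶ B => GSet.Hom.app h hk x) h₂))

end pullback

section circ

variable {n : ℕ} {X X' Y Y' Z : GSet.{u} n}

theorem map_bang (f : X ⟶ X') : (T n).map f ≫ (T n).map X'.bang = (T n).map X.bang := by
  rw [← Functor.map_comp, GSet.hom_one_ext (f ≫ X'.bang) X.bang]

/-- For collections `x` on `X` and `y` on `Y`, the map to `1^*` from the `n`-globular set of pairs
of a cell `p` of `X^*` and a cell `b` of `Y` such that `!^*(p)` is the shape `y(b)`. -/
noncomputable def circHom (x : X ⟶ shapes n) (y : Y ⟶ shapes n) :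
    pb ((T n).map X.bang) y ⟶ shapes n :=
  pb.fst _ _ ≫ (T n).map x ≫ (T n).μ.app (GSet.one n)

theorem circMap_w {y : Y ⟶ shapes n} {y' : Y' ⟶ shapes n} (f : X ⟶ X') (g : Y ⟶ Y')
    (hg : g ≫ y' = y) :
    (pb.fst ((T n).map X.bang) y ≫ (T n).map f) ≫ (T n).map X'.bang = (pb.snd _ _ ≫ g) ≫ y' := by
  rw [Category.assoc, map_bang, pb.condition, Category.assoc, hg]

theorem circMap_hom {x : X ⟶ shapes n} {x' : X' ⟶ shapes n} {y : Y ⟶ shapes n}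
    {y' : Y' ⟶ shapes n} (f : X ⟶ X') (g : Y ⟶ Y') (hf : f ≫ x' = x) (hg : g ≫ y' = y) :
    pb.lift (pb.fst _ _ ≫ (T n).map f) (pb.snd _ _ ≫ g) (circMap_w f g hg) ≫ circHom x' y' =
      circHom x y := by
  subst hf
  rw [circHom, pb.lift_fst_comp, circHom, Category.assoc, Functor.map_comp, Category.assoc]

theorem leftUnit_w (x : X ⟶ shapes n) : x ≫ (T n).map (GSet.one n).bang = 𝟙 X ≫ x := by
  rw [GSet.hom_one_ext (GSet.bang _) (𝟙 _), CategoryTheory.Functor.map_id, Category.comp_id, Category.id_comp]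

theorem leftUnit_hom (x : X ⟶ shapes n) :
    pb.lift x (𝟙 X) (leftUnit_w x) ≫ circHom ((T n).η.app (GSet.one n)) x = x := by
  have h : (T n).map ((T n).η.app (GSet.one n)) ≫ (T n).μ.app (GSet.one n) = 𝟙 (shapes n) :=
    (T n).right_unit _
  calc _ = x ≫ (T n).map ((T n).η.app (GSet.one n)) ≫ (T n).μ.app (GSet.one n) := rfl
    _ = x := by rw [h, Category.comp_id]

theorem rightUnit_w (X : GSet.{u} n) :
    (T n).η.app X ≫ (T n).map X.bang = X.bang ≫ (T n).η.app (GSet.one n) :=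
  ((T n).η.naturality X.bang).symm

theorem rightUnit_hom (x : X ⟶ shapes n) :
    pb.lift ((T n).η.app X) X.bang (rightUnit_w X) ≫ circHom x ((T n).η.app (GSet.one n)) = x := by
  have h : x ≫ (T n).η.app (shapes n) = (T n).η.app X ≫ (T n).map x := (T n).η.naturality x
  have h' : (T n).η.app (shapes n) ≫ (T n).μ.app (GSet.one n) = 𝟙 (shapes n) := (T n).left_unit _
  rw [circHom, pb.lift_fst_comp, ← Category.assoc, ← h, Category.assoc, h', Category.comp_id]

theorem assoc_w (y : Y ⟶ shapes n) (z : Z ⟶ shapes n) :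
    (pb.fst ((T n).map (pb ((T n).map X.bang) y).bang) z ≫
      (T n).map (pb.snd ((T n).map X.bang) y)) ≫ (T n).map Y.bang = pb.snd _ _ ≫ z := by
  rw [Category.assoc, map_bang, pb.condition]

theorem mu_bang (x : X ⟶ Y) :
    (T n).μ.app X ≫ (T n).map x = (T n).map ((T n).map x) ≫ (T n).μ.app Y :=
  ((T n).μ.naturality x).symm

theorem assoc_w' (y : Y ⟶ shapes n) (z : Z ⟶ shapes n) :
    (pb.fst ((T n).map (pb ((T n).map X.bang) y).bang) z ≫
      (T n).map (pb.fst ((T n).map X.bang) y) ≫ (T n).μ.app X) ≫ (T n).map X.bang =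
    pb.lift (pb.fst _ _ ≫ (T n).map (pb.snd _ _)) (pb.snd _ _) (assoc_w y z) ≫ circHom y z := by
  rw [circHom, pb.lift_fst_comp]
  simp only [Category.assoc]
  rw [mu_bang, ← Functor.map_comp_assoc, pb.condition, Functor.map_comp_assoc]

theorem assoc_hom (x : X ⟶ shapes n) (y : Y ⟶ shapes n) (z : Z ⟶ shapes n) :
    pb.lift (pb.fst _ _ ≫ (T n).map (pb.fst _ _) ≫ (T n).μ.app X)
      (pb.lift (pb.fst _ _ ≫ (T n).map (pb.snd _ _)) (pb.snd _ _) (assoc_w y z))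
      (assoc_w' y z) ≫ circHom x (circHom y z) = circHom (circHom x y) z := by
  have h : (T n).map ((T n).μ.app (GSet.one n)) ≫ (T n).μ.app (GSet.one n) =
    (T n).μ.app (shapes n) ≫ (T n).μ.app (GSet.one n) := (T n).assoc _
  refine (pb.lift_fst_comp _ _ _ _).trans ?_
  change _ = pb.fst _ _ ≫ (T n).map (pb.fst _ _ ≫ (T n).map x ≫ (T n).μ.app (GSet.one n)) ≫ _
  rw [Functor.map_comp, Functor.map_comp]
  simp only [Category.assoc]
  rw [h, ← Category.assoc ((T n).μ.app X), mu_bang, Category.assoc]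

end circ

/-- The category of `n`-globular collections: the slice of `n`-globular sets over `1^*`. -/
abbrev Coll (n : ℕ) := Over (shapes.{u} n)

namespace Coll

variable {n : ℕ}

/-- The composite collection `X ∘ Y`: its cells are the pairs `(p, y)` of a cell `p` of `X^*` and
a cell `y` of `Y` such that `!^*(p)` is the shape of `y`. -/
noncomputable def circ (X Y : Coll.{u} n) : Coll.{u} n := Over.mk (circHom X.hom Y.hom)

/-- The unit collection `η : 1 ⟶ 1^*`. -/
noncomputable def unit (n : ℕ) : Coll.{u} n := Over.mk ((T n).η.app (GSet.one n))

/-- The action of `∘` on morphisms. -/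
noncomputable def circMap {X X' Y Y' : Coll.{u} n} (f : X ⟶ X') (g : Y ⟶ Y') :
    circ X Y ⟶ circ X' Y' :=
  Over.homMk (U := circ X Y) (V := circ X' Y')
    (pb.lift (pb.fst _ _ ≫ (T n).map f.left) (pb.snd _ _ ≫ g.left) (circMap_w _ _ (Over.w g)))
    (circMap_hom _ _ (Over.w f) (Over.w g))

/-- The inverse of the left unit isomorphism. -/
noncomputable def leftUnitInv (X : Coll.{u} n) : X ⟶ circ (unit n) X :=
  Over.homMk (V := circ (unit n) X) (pb.lift X.hom (𝟙 X.left) (leftUnit_w X.hom))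
    (leftUnit_hom X.hom)

/-- The inverse of the right unit isomorphism. -/
noncomputable def rightUnitInv (X : Coll.{u} n) : X ⟶ circ X (unit n) :=
  Over.homMk (V := circ X (unit n))
    (pb.lift ((T n).η.app X.left) X.left.bang (rightUnit_w X.left)) (rightUnit_hom X.hom)

/-- The associativity isomorphism. -/
noncomputable def assoc (X Y Z : Coll.{u} n) : circ (circ X Y) Z ⟶ circ X (circ Y Z) :=
  Over.homMk (U := circ (circ X Y) Z) (V := circ X (circ Y Z))
    (pb.lift (pb.fst _ _ ≫ (T n).map (pb.fst _ _) ≫ (T n).μ.app X.left)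
      (pb.lift (pb.fst _ _ ≫ (T n).map (pb.snd _ _)) (pb.snd _ _) (assoc_w Y.hom Z.hom))
      (assoc_w' Y.hom Z.hom))
    (assoc_hom X.hom Y.hom Z.hom)

theorem circMap_comp {X X' X'' Y Y' Y'' : Coll.{u} n} (f : X ⟶ X') (f' : X' ⟶ X'') (g : Y ⟶ Y')
    (g' : Y' ⟶ Y'') : circMap (f ≫ f') (g ≫ g') = circMap f g ≫ circMap f' g' := by
  apply Over.OverMorphism.ext
  apply pb.hom_ext
  · change pb.fst _ _ ≫ (T n).map (f.left ≫ f'.left) =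
      pb.fst _ _ ≫ (T n).map f.left ≫ (T n).map f'.left
    rw [Functor.map_comp]
  · rfl

theorem circMap_id (X Y : Coll.{u} n) : circMap (𝟙 X) (𝟙 Y) = 𝟙 (circ X Y) := by
  apply Over.OverMorphism.ext
  apply pb.hom_ext
  · change pb.fst _ _ ≫ (T n).map (𝟙 X.left) = pb.fst _ _
    exact (congrArg (fun t => pb.fst _ _ ≫ t) ((T n).map_id X.left)).trans (Category.comp_id _)
  · rfl

end Coll

/-- An `n`-globular operad: a monoid in the monoidal category of `n`-globular collections. -/
structure Operad (n : ℕ) where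
  coll : Coll.{u} n
  ids : Coll.unit n ⟶ coll
  comp : Coll.circ coll coll ⟶ coll
  ids_comp : Coll.leftUnitInv coll ≫ Coll.circMap ids (𝟙 coll) ≫ comp = 𝟙 coll
  comp_ids : Coll.rightUnitInv coll ≫ Coll.circMap (𝟙 coll) ids ≫ comp = 𝟙 coll
  assoc : Coll.circMap comp (𝟙 coll) ≫ comp =
    Coll.assoc coll coll coll ≫ Coll.circMap (𝟙 coll) comp ≫ comp

/-- A morphism of `n`-globular operads: a morphism of monoids. -/
@[ext]
structure Operad.Hom {n : ℕ} (G H : Operad.{u} n) where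
  hom : G.coll ⟶ H.coll
  ids_hom : G.ids ≫ hom = H.ids
  comp_hom : G.comp ≫ hom = Coll.circMap hom hom ≫ H.comp

/-- The category of `n`-globular operads. -/
noncomputable instance Operad.category (n : ℕ) : Category.{u} (Operad.{u} n) where
  Hom := Operad.Hom
  id G :=
    { hom := 𝟙 G.coll
      ids_hom := Category.comp_id _
      comp_hom := by rw [Coll.circMap_id, Category.comp_id, Category.id_comp] }
  comp f g :=
    { hom := f.hom ≫ g.hom
      ids_hom := by rw [← Category.assoc, f.ids_hom, g.ids_hom]
      comp_hom := by
        rw [← Category.assoc, f.comp_hom, Category.assoc, g.comp_hom, Coll.circMap_comp,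
          Category.assoc] }
  id_comp f := Operad.Hom.ext (Category.id_comp f.hom)
  comp_id f := Operad.Hom.ext (Category.comp_id f.hom)
  assoc f g h := Operad.Hom.ext (Category.assoc f.hom g.hom h.hom)

namespace Operad

variable {n : ℕ}

/-- The `k`-cells of an operad. -/
noncomputable abbrev Cell (G : Operad.{u} n) (k : ℕ) (hk : k ≤ n) : Type u := G.coll.left.cell k hk

/-- The `k`-cells `((Λ₁, …, Λₘ), Λ)` of `G ∘ G`. -/
noncomputable abbrev Composable (G : Operad.{u} n) (k : ℕ) (hk : k ≤ n) : Type u :=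
  (Coll.circ G.coll G.coll).left.cell k hk

/-- The source of a cell of an operad. -/
noncomputable abbrev src (G : Operad.{u} n) {k : ℕ} (hk : k + 1 ≤ n) (x : G.Cell (k + 1) hk) :
    G.Cell k (Nat.le_of_succ_le hk) := G.coll.left.src hk x

/-- The target of a cell of an operad. -/
noncomputable abbrev tgt (G : Operad.{u} n) {k : ℕ} (hk : k + 1 ≤ n) (x : G.Cell (k + 1) hk) :
    G.Cell k (Nat.le_of_succ_le hk) := G.coll.left.tgt hk x

/-- The shape `g(x)` of a cell of an operad. -/
noncomputable abbrev shape (G : Operad.{u} n) {k : ℕ} (hk : k ≤ n) (x : G.Cell k hk) :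
    (shapes.{u} n).cell k hk := G.coll.hom.app hk x

/-- The identity `k`-cell `id_k` of an operad. -/
noncomputable abbrev idCell (G : Operad.{u} n) {k : ℕ} (hk : k ≤ n) : G.Cell k hk :=
  G.ids.left.app hk PUnit.unit

/-- The operadic composite `Λ ∘ (Λ₁, …, Λₘ)` of a cell `((Λ₁, …, Λₘ), Λ)` of `G ∘ G`. -/
noncomputable abbrev composite (G : Operad.{u} n) {k : ℕ} (hk : k ≤ n) (z : G.Composable k hk) : G.Cell k hk :=
  G.comp.left.app hk z

/-- The `k`-cell of `G ∘ G` formed by a cell `p = (Λ₁, …, Λₘ)` of `G^*` and a cell `Λ` of `G`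
whose shape is that of `p`. -/
noncomputable def pair (G : Operad.{u} n) {k : ℕ} (hk : k ≤ n) (p : ((T n).obj G.coll.left).cell k hk)
    (Λ : G.Cell k hk) (h : ((T n).map G.coll.left.bang).app hk p = G.shape hk Λ) :
    G.Composable k hk := ⟨(p, Λ), h⟩

/-- The value of a morphism of operads on a cell. -/
noncomputable abbrev mapCell {G H : Operad.{u} n} (f : G ⟶ H) {k : ℕ} (hk : k ≤ n) (x : G.Cell k hk) :
    H.Cell k hk := (Operad.Hom.hom f).left.app hk x

end Operad

/-! ## Contractibility -/

/-- Two cells of positive dimension are parallel if they have the same source and the same target;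
all pairs of `0`-cells are parallel. -/
def GSet.Parallel {n : ℕ} (X : GSet.{u} n) :
    ∀ {k : ℕ} (hk : k ≤ n), X.cell k hk → X.cell k hk → Prop
  | 0, _, _, _ => True
  | _ + 1, hk, x, y => X.src hk x = X.src hk y ∧ X.tgt hk x = X.tgt hk y

/-- A contraction function on an `n`-globular collection. -/
structure Contraction {n : ℕ} (X : Coll.{u} n) where
  fill : ∀ {k : ℕ} (hk : k + 1 ≤ n) (x x' : X.left.cell k (Nat.le_of_succ_le hk))
    (τ : (shapes.{u} n).cell (k + 1) hk), X.left.Parallel (Nat.le_of_succ_le hk) x x' →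
    X.hom.app _ x = bdry hk τ → X.hom.app _ x' = bdry hk τ → X.left.cell (k + 1) hk
  src_fill : ∀ {k : ℕ} (hk : k + 1 ≤ n) (x x') (τ) (h h₁ h₂),
    X.left.src hk (fill (k := k) hk x x' τ h h₁ h₂) = x
  tgt_fill : ∀ {k : ℕ} (hk : k + 1 ≤ n) (x x') (τ) (h h₁ h₂),
    X.left.tgt hk (fill (k := k) hk x x' τ h h₁ h₂) = x'
  hom_fill : ∀ {k : ℕ} (hk : k + 1 ≤ n) (x x') (τ) (h h₁ h₂),
    X.hom.app hk (fill (k := k) hk x x' τ h h₁ h₂) = τ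

namespace Operad

variable {n : ℕ}

/-- Parallel `n`-cells of `G` with the same shape are equal. -/
def TopUnique (G : Operad.{u} n) : Prop :=
  ∀ χ χ' : G.Cell n le_rfl, G.coll.left.Parallel le_rfl χ χ' →
    G.shape le_rfl χ = G.shape le_rfl χ' → χ = χ'

/-- An `n`-globular operad is contractible if its collection admits a contraction function and
parallel `n`-cells with the same shape are equal. -/
def Contractible (G : Operad.{u} n) : Prop := Nonempty (Contraction G.coll) ∧ G.TopUnique

/-- The cell `χ` is a possible value for the composite of the cell `z = ((Λ₁, …, Λₘ), Λ)` of
`G ∘ G`: it has the shape of `z` and, in positive dimension, it goes from the composite of the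
source of `z` to the composite of the target of `z`. -/
def IsCompositeFor (G : Operad.{u} n) :
    ∀ {k : ℕ} (hk : k ≤ n), G.Composable k hk → G.Cell k hk → Prop
  | 0, hk, z, χ => G.shape hk χ = (Coll.circ G.coll G.coll).hom.app hk z
  | _ + 1, hk, z, χ =>
    G.src hk χ = G.composite _ ((Coll.circ G.coll G.coll).left.src hk z) ∧
    G.tgt hk χ = G.composite _ ((Coll.circ G.coll G.coll).left.tgt hk z) ∧
    G.shape hk χ = (Coll.circ G.coll G.coll).hom.app hk z

end Operad

/-- Given functions `f` on cells of dimension `< n`, `Relabel f hk p p'` says that the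
`k`-dimensional pasting diagram `p'` in `Y` is obtained from the pasting diagram `p` in `X` by
applying `f` to each of its cells. -/
inductive Relabel {n : ℕ} {X Y : GSet.{u} n}
    (f : ∀ {k : ℕ} (hk : k < n), X.cell k hk.le → Y.cell k hk.le) :
    ∀ {k : ℕ} (hk : k < n), ((free n).obj X).cell k hk.le → ((free n).obj Y).cell k hk.le → Prop
  | gen {k : ℕ} (hk : k < n) (x : X.cell k hk.le) :
      Relabel f hk (((freeAdj n).unit.app X).app hk.le x)
        (((freeAdj n).unit.app Y).app hk.le (f hk x))
  | idt {k : ℕ} (hk : k + 1 < n) (p : ((free n).obj X).cell k (Nat.lt_of_succ_lt hk).le)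
      (p' : ((free n).obj Y).cell k (Nat.lt_of_succ_lt hk).le) :
      Relabel f (Nat.lt_of_succ_lt hk) p p' →
      Relabel f hk (((free n).obj X).idt hk.le p) (((free n).obj Y).idt hk.le p')
  | comp {k : ℕ} (hk : k < n) (j : ℕ) (hj : j < k) (p q : ((free n).obj X).cell k hk.le)
      (p' q' : ((free n).obj Y).cell k hk.le) (h) (h') :
      Relabel f hk p p' → Relabel f hk q q' →
      Relabel f hk (((free n).obj X).comp hk.le j hj p q h)
        (((free n).obj Y).comp hk.le j hj p' q' h')

/-- An isomorphism between the parts of two `n`-globular operads in dimensions `< n`: bijections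
between the `k`-cells for `k < n` that respect sources, targets, shapes, identities and operadic
composition. -/
structure LowIso {n : ℕ} (G H : Operad.{u} n) where
  equiv : ∀ {k : ℕ} (hk : k < n), G.Cell k hk.le ≃ H.Cell k hk.le
  map_src : ∀ {k : ℕ} (hk : k + 1 < n) (x : G.Cell (k + 1) hk.le),
    equiv (Nat.lt_of_succ_lt hk) (G.src hk.le x) = H.src hk.le (equiv hk x)
  map_tgt : ∀ {k : ℕ} (hk : k + 1 < n) (x : G.Cell (k + 1) hk.le),
    equiv (Nat.lt_of_succ_lt hk) (G.tgt hk.le x) = H.tgt hk.le (equiv hk x)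
  map_shape : ∀ {k : ℕ} (hk : k < n) (x : G.Cell k hk.le),
    H.shape hk.le (equiv hk x) = G.shape hk.le x
  map_id : ∀ {k : ℕ} (hk : k < n), equiv hk (G.idCell hk.le) = H.idCell hk.le
  map_composite : ∀ {k : ℕ} (hk : k < n) (p : ((T n).obj G.coll.left).cell k hk.le)
    (p' : ((T n).obj H.coll.left).cell k hk.le) (Λ : G.Cell k hk.le) (h h'),
    Relabel (fun hk => equiv hk) hk p p' →
    equiv hk (G.composite hk.le (G.pair hk.le p Λ h)) =
      H.composite hk.le (H.pair hk.le p' (equiv hk Λ) h')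

end NGlob

/-! The engine is condition (ii): an `n`-cell of an operad satisfying it is pinned down by its
boundary and its shape. A map of collections preserves both, so two maps of collections into such an
operad that agree in dimensions below `n` also agree in dimension `n`: on a top cell they have the
same shape, and the boundaries of its two images lie in dimension `n - 1`. This is
`TopUnique.hom_ext`. No condition on the domain is needed, so it applies to maps out of the unit
collection, out of `G ∘ G` and out of `G` itself.

Uniqueness in all three statements rests on condition (ii). Part 3 is `TopUnique.hom_ext` for the
underlying maps of operad morphisms. In part 1 the contraction supplies a filler and (ii) makes it
unique; an operadic composite has the prescribed shape and boundary because operadic composition is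
itself a map of collections.

For part 2, let `φ` be an isomorphism in dimensions below `n`. The source and target of a top cell
`x` of `G` are parallel, both of shape `∂g(x)`, so `φ` sends them to a parallel pair in `H` which
the contraction of `H` fills by a cell of shape `g(x)` (`exists_isLift`). Choosing such fillers
extends `φ` to a map of collections. The unit law, the multiplication law and the inverse laws are
then equalities of maps into an operad satisfying (ii), so they need checking only below `n`. There
the multiplication law requires that `(-)^*` of the extension relabels pasting diagrams by `φ`,
which is `relabel_map`. For `n = 0` there is no boundary to fill, but `1^*` has a single `0`-cell
and any `0`-cell of `H` serves as the image. -/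

namespace NGlob

variable {n : ℕ}

/-! ### Shapes and relabelled pasting diagrams -/

/-- There is only one shape of dimension `0`. -/
theorem shapes_zero_ext (h0 : 0 ≤ n) (τ τ' : (shapes.{u} n).cell 0 h0) : τ = τ' := by
  have key : ∀ {m : ℕ} (hm : m ≤ n) (x : (freeObj (GSet.one.{u} n)).cell m hm), m = 0 →
      x = (freeIncl (GSet.one n)).app hm PUnit.unit := by
    intro m hm x
    -- Identities raise the dimension and composition needs some `j < k`, so only generators can
    -- occur in dimension `0`, and the terminal globular set has just one. The dimension is a
    -- variable with `m = 0` as a premise because the induction runs over cells of all dimensions.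
    refine free_induction (P := fun {m} hm x => m = 0 →
      x = (freeIncl (GSet.one n)).app hm PUnit.unit) ?_ ?_ ?_ hm x
    · intros; rfl
    · intro k hk x _ h
      omega
    · intro k hk j hj x y _ _ _ h
      omega
  exact (key h0 τ rfl).trans (key h0 τ' rfl).symm

/-- The functor `(-)^*` relabels the cells of a pasting diagram. -/
theorem relabel_map {X Y : GSet.{u} n} (F : X ⟶ Y)
    (f : ∀ {k : ℕ} (hk : k < n), X.cell k hk.le → Y.cell k hk.le)
    (hF : ∀ {k : ℕ} (hk : k < n) (x : X.cell k hk.le), F.app hk.le x = f hk x)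
    {k : ℕ} (hk : k < n) (p : ((T n).obj X).cell k hk.le) :
    Relabel f hk p (((T n).map F).app hk.le p) := by
  -- Naturality of the unit: generators go to generators. The other two cases use that `F^*`
  -- underlies a strict `n`-functor.
  have hgen {k : ℕ} (hk : k ≤ n) (x : X.cell k hk) :
      ((T n).map F).app hk (((T n).η.app X).app hk x) = ((T n).η.app Y).app hk (F.app hk x) :=
    congrArg (fun h : X ⟶ (T n).obj Y => GSet.Hom.app h hk x) ((T n).η.naturality F).symm
  refine free_induction (X := X) (P := fun {k} hk' p => ∀ hk : k < n,
    Relabel f hk p (((T n).map F).app hk' p)) ?_ ?_ ?_ hk.le p hk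
  · intro k hk' x hk
    have h := Relabel.gen (f := f) hk x
    rw [← hF hk x] at h
    exact (hgen hk' x).symm ▸ h
  · intro k hk' p ih hk
    have h := Relabel.idt (f := f) hk p _ (ih (Nat.lt_of_succ_lt hk))
    exact (StrCat.Hom.app_idt ((free n).map F) hk' p).symm ▸ h
  · intro k hk' j hj p q h ihp ihq hk
    have hc := StrCat.Hom.composable (StrCat.Hom.toHom ((free n).map F)) hk' j hj p q h
    have hr := Relabel.comp (f := f) hk j hj p q _ _ h hc (ihp hk) (ihq hk)
    exact (StrCat.Hom.app_comp ((free n).map F) hk' j hj p q h hc).symm ▸ hr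

/-! ### Top cells determined by boundary and shape -/

namespace Operad

variable {G H : Operad.{u} n}

theorem shape_comp {k : ℕ} {hk : k ≤ n} (z : G.Composable k hk) :
    G.shape hk (G.composite hk z) = (Coll.circ G.coll G.coll).hom.app hk z :=
  congrArg (fun h : (Coll.circ G.coll G.coll).left ⟶ shapes n => GSet.Hom.app h hk z)
    (Over.w G.comp)

/-- Condition (ii) in a variable dimension `k`, the form that arises after splitting on `k < n` and
still permits splitting `k` into zero and successor. -/
theorem TopUnique.eq (hG : G.TopUnique) {k : ℕ} {hk : k ≤ n} (hkn : ¬ k < n) {x x' : G.Cell k hk}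
    (h : G.coll.left.Parallel hk x x') (hs : G.shape hk x = G.shape hk x') : x = x' := by
  obtain rfl : k = n := by omega
  exact hG x x' h hs

/-- Two maps of cells over the shapes into an operad with unique top cells are equal if they
agree below the top dimension. -/
theorem TopUnique.hom_ext (hH : H.TopUnique) {X : Coll.{u} n} {a b : X ⟶ H.coll}
    (h : ∀ {k : ℕ} (hk : k < n) (x : X.left.cell k hk.le),
      a.left.app hk.le x = b.left.app hk.le x) : a = b := by
  apply Over.OverMorphism.ext
  apply GSet.hom_ext
  intro k hk x
  by_cases hkn : k < n
  · exact h hkn x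
  · refine hH.eq hkn ?_ ?_
    · cases k with
      | zero => trivial
      -- The bound `k + 1 ≤ n` is by definition `k < n`, so the agreement hypothesis applies to the
      -- boundary.
      | succ k => exact ⟨by rw [← a.left.app_src, ← b.left.app_src, h hk],
          by rw [← a.left.app_tgt, ← b.left.app_tgt, h hk]⟩
    -- The shapes agree because `a` and `b` are both maps over `1^*`.
    · have w := (Over.w a).trans (Over.w b).symm
      exact congrArg (fun h : X.left ⟶ shapes n => GSet.Hom.app h hk x) w

/-- Being a monoid morphism is a property of the underlying map of collections, so the comparison of
collection maps suffices. -/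
theorem TopUnique.operadHom_ext (hH : H.TopUnique) {f f' : G ⟶ H}
    (h : ∀ (k : ℕ) (hk : k < n) (x : G.Cell k hk.le), mapCell f hk.le x = mapCell f' hk.le x) :
    f = f' :=
  Operad.Hom.ext (hH.hom_ext fun hk x => h _ hk x)

/-- Operadic composition is a morphism of globular sets over `1^*`: it commutes with sources and
targets and preserves shape. -/
theorem isCompositeFor_composite {k : ℕ} {hk : k ≤ n} (z : G.Composable k hk) :
    G.IsCompositeFor hk z (G.composite hk z) := by
  cases k with
  | zero => exact shape_comp z
  | succ k => exact ⟨(G.comp.left.app_src hk z).symm, (G.comp.left.app_tgt hk z).symm, shape_comp z⟩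

theorem IsCompositeFor.parallel {k : ℕ} {hk : k ≤ n} {z : G.Composable k hk} {χ χ' : G.Cell k hk}
    (h : G.IsCompositeFor hk z χ) (h' : G.IsCompositeFor hk z χ') :
    G.coll.left.Parallel hk χ χ' ∧ G.shape hk χ = G.shape hk χ' := by
  cases k with
  | zero => exact ⟨trivial, Eq.trans h (Eq.symm h')⟩
  | succ k => exact ⟨⟨h.1.trans h'.1.symm, h.2.1.trans h'.2.1.symm⟩, h.2.2.trans h'.2.2.symm⟩

theorem TopUnique.isCompositeFor_iff (hG : G.TopUnique) (z : G.Composable n le_rfl)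
    (χ : G.Cell n le_rfl) : G.IsCompositeFor le_rfl z χ ↔ χ = G.composite le_rfl z := by
  constructor
  · intro h
    obtain ⟨hp, hs⟩ := h.parallel (isCompositeFor_composite z)
    exact hG _ _ hp hs
  · rintro rfl
    exact isCompositeFor_composite z

/-- Condition (i) gives existence and condition (ii) uniqueness. Writing `n` as `k + 1` encodes `n ≥
1` and avoids truncated subtraction. -/
theorem Contractible.existsUnique_fill (hG : G.Contractible) {k : ℕ} (hk : k + 1 = n)
    (x x' : G.Cell k (Nat.le_of_succ_le hk.le)) (τ : (shapes.{u} n).cell (k + 1) hk.le)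
    (hp : G.coll.left.Parallel _ x x') (hx : G.shape _ x = bdry hk.le τ)
    (hx' : G.shape _ x' = bdry hk.le τ) :
    ∃! χ : G.Cell (k + 1) hk.le,
      G.src hk.le χ = x ∧ G.tgt hk.le χ = x' ∧ G.shape hk.le χ = τ := by
  obtain ⟨⟨c⟩, hu⟩ := hG
  refine ⟨c.fill hk.le x x' τ hp hx hx', ⟨c.src_fill .., c.tgt_fill .., c.hom_fill ..⟩, ?_⟩
  rintro χ ⟨hs, ht, hτ⟩
  refine hu.eq (by omega) ⟨?_, ?_⟩ ?_
  · exact hs.trans (c.src_fill ..).symm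
  · exact ht.trans (c.tgt_fill ..).symm
  · exact hτ.trans (c.hom_fill ..).symm

end Operad

/-! ### Inverting an isomorphism in dimensions below `n` -/

/-- The rules for identities and composites treat the two diagrams symmetrically; only the rule for
generators mentions `f`, and there `g` undoes it. This is what makes compatibility with operadic
composites pass to the inverse bijections. -/
theorem Relabel.symm {X Y : GSet.{u} n}
    {f : ∀ {k : ℕ} (hk : k < n), X.cell k hk.le → Y.cell k hk.le}
    {g : ∀ {k : ℕ} (hk : k < n), Y.cell k hk.le → X.cell k hk.le}
    (hfg : ∀ {k : ℕ} (hk : k < n) (x : X.cell k hk.le), g hk (f hk x) = x)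
    {k : ℕ} {hk : k < n} {p : ((free n).obj X).cell k hk.le} {p' : ((free n).obj Y).cell k hk.le}
    (h : Relabel f hk p p') : Relabel g hk p' p := by
  induction h with
  | gen hk x =>
    have h := Relabel.gen (f := g) hk (f hk x)
    rwa [hfg hk x] at h
  | idt hk p p' _ ih => exact .idt hk _ _ ih
  | comp hk j hj p q p' q' h h' _ _ ihp ihq => exact .comp hk j hj _ _ _ _ h' h ihp ihq

namespace LowIso

variable {G H : Operad.{u} n}

/-- The inverse of an isomorphism in dimensions `< n`. -/
noncomputable def symm (φ : LowIso G H) : LowIso H G where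
  equiv hk := (φ.equiv hk).symm
  map_src hk x := by rw [Equiv.symm_apply_eq, φ.map_src hk, Equiv.apply_symm_apply]
  map_tgt hk x := by rw [Equiv.symm_apply_eq, φ.map_tgt hk, Equiv.apply_symm_apply]
  map_shape hk x := by rw [← φ.map_shape hk, Equiv.apply_symm_apply]
  map_id hk := by rw [Equiv.symm_apply_eq, φ.map_id]
  map_composite {k} hk p p' Λ h h' hr := by
    -- With `Λ` written as an image under `φ`, the claim becomes the law of `φ` for the reversed
    -- relabelling, read from right to left.
    obtain ⟨Λ, rfl⟩ := (φ.equiv hk).surjective Λ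
    rw [Equiv.symm_apply_eq]
    simp only [Equiv.symm_apply_apply] at h' ⊢
    exact (φ.map_composite hk p' p Λ h' h
      (hr.symm fun hk x => (φ.equiv hk).apply_symm_apply x)).symm

theorem parallel (φ : LowIso G H) {k : ℕ} (hk : k < n) {x x' : G.Cell k hk.le}
    (h : G.coll.left.Parallel hk.le x x') :
    H.coll.left.Parallel hk.le (φ.equiv hk x) (φ.equiv hk x') := by
  cases k with
  | zero => trivial
  | succ k =>
    obtain ⟨hs, ht⟩ := h
    refine ⟨?_, ?_⟩
    · exact (φ.map_src hk x).symm.trans ((congrArg _ hs).trans (φ.map_src hk x'))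
    · exact (φ.map_tgt hk x).symm.trans ((congrArg _ ht).trans (φ.map_tgt hk x'))

/-! ### Lifting top cells along the contraction -/

/-- The cell `y` of `H` has the shape of the cell `x` of `G`, and its boundary corresponds to the
boundary of `x`. -/
def IsLift (φ : LowIso G H) : ∀ {k : ℕ} (hk : k ≤ n), G.Cell k hk → H.Cell k hk → Prop
  | 0, hk, x, y => H.shape hk y = G.shape hk x
  | _ + 1, hk, x, y =>
    H.src hk y = φ.equiv hk (G.src hk x) ∧ H.tgt hk y = φ.equiv hk (G.tgt hk x) ∧
      H.shape hk y = G.shape hk x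

theorem isLift_equiv (φ : LowIso G H) {k : ℕ} (hk : k < n) (x : G.Cell k hk.le) :
    φ.IsLift hk.le x (φ.equiv hk x) := by
  cases k with
  | zero => exact φ.map_shape hk x
  | succ k => exact ⟨(φ.map_src hk x).symm, (φ.map_tgt hk x).symm, φ.map_shape hk x⟩

theorem IsLift.shape {φ : LowIso G H} {k : ℕ} {hk : k ≤ n} {x : G.Cell k hk} {y : H.Cell k hk}
    (h : φ.IsLift hk x y) : H.shape hk y = G.shape hk x := by
  cases k with
  | zero => exact h
  | succ k => exact h.2.2

/-- The only place in the extension of `φ` where a contraction function is used: it fills the image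
under `φ` of the boundary of `x`. -/
theorem exists_isLift (φ : LowIso G H) (hH : H.Contractible) {k : ℕ} (hk : k ≤ n)
    (x : G.Cell k hk) : ∃ y, φ.IsLift hk x y := by
  cases k with
  -- In dimension `0` only the shape is constrained, and there is a single shape. The identity
  -- serves merely as some `0`-cell of `H`.
  | zero => exact ⟨H.idCell hk, shapes_zero_ext hk _ _⟩
  | succ k =>
    obtain ⟨⟨c⟩, -⟩ := hH
    -- The two ends of a cell are parallel by globularity.
    have hp : G.coll.left.Parallel (Nat.le_of_succ_le hk) (G.src hk x) (G.tgt hk x) := by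
      cases k with
      | zero => trivial
      | succ k => exact ⟨G.coll.left.src_src hk x, G.coll.left.tgt_src hk x⟩
    have hs : H.shape _ (φ.equiv hk (G.src hk x)) = bdry hk (G.shape hk x) :=
      (φ.map_shape hk _).trans (G.coll.hom.app_src hk x)
    -- Since `bdry` is defined as the source, the target side needs that source and target of a
    -- shape coincide.
    have ht : H.shape _ (φ.equiv hk (G.tgt hk x)) = bdry hk (G.shape hk x) :=
      ((φ.map_shape hk _).trans (G.coll.hom.app_tgt hk x)).trans (bdry_eq_tgt hk _).symm
    exact ⟨c.fill hk _ _ (G.shape hk x) (φ.parallel hk hp) hs ht, c.src_fill .., c.tgt_fill ..,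
      c.hom_fill ..⟩

open Classical in
/-- The extension of an isomorphism in dimensions `< n` to all cells. -/
noncomputable def extendCell (φ : LowIso G H) (hH : H.Contractible) {k : ℕ} (hk : k ≤ n)
    (x : G.Cell k hk) : H.Cell k hk :=
  -- The second branch occurs only for `k = n`, where condition (ii) for `H` leaves just one lift,
  -- so the choice is harmless.
  if h : k < n then φ.equiv h x else (φ.exists_isLift hH hk x).choose

theorem extendCell_of_lt (φ : LowIso G H) (hH : H.Contractible) {k : ℕ} (hk : k < n)
    (x : G.Cell k hk.le) : φ.extendCell hH hk.le x = φ.equiv hk x :=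
  dif_pos hk

/-- One statement for all dimensions, from which compatibility of the extension with sources,
targets and shapes is read off. -/
theorem isLift_extendCell (φ : LowIso G H) (hH : H.Contractible) {k : ℕ} (hk : k ≤ n)
    (x : G.Cell k hk) : φ.IsLift hk x (φ.extendCell hH hk x) := by
  by_cases h : k < n
  · rw [φ.extendCell_of_lt hH h]
    exact φ.isLift_equiv h x
  · rw [extendCell, dif_neg h]
    exact (φ.exists_isLift hH hk x).choose_spec

/-! ### The extension as an isomorphism of operads -/

/-- The morphism of `n`-globular sets extending an isomorphism in dimensions `< n`. -/
noncomputable def extendGSet (φ : LowIso G H) (hH : H.Contractible) :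
    G.coll.left ⟶ H.coll.left where
  app hk x := φ.extendCell hH hk x
  -- The boundary of a cell has dimension below `n`, so the extension acts on it as `φ`.
  app_src hk x := (φ.extendCell_of_lt hH hk _).trans (φ.isLift_extendCell hH hk x).1.symm
  app_tgt hk x := (φ.extendCell_of_lt hH hk _).trans (φ.isLift_extendCell hH hk x).2.1.symm

/-- The morphism of collections extending an isomorphism in dimensions `< n`. -/
noncomputable def extendColl (φ : LowIso G H) (hH : H.Contractible) : G.coll ⟶ H.coll :=
  Over.homMk (φ.extendGSet hH)
    (GSet.hom_ext fun _ hk x => (φ.isLift_extendCell hH hk x).shape)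

theorem extendColl_app (φ : LowIso G H) (hH : H.Contractible) {k : ℕ} (hk : k < n)
    (x : G.Cell k hk.le) : (φ.extendColl hH).left.app hk.le x = φ.equiv hk x :=
  φ.extendCell_of_lt hH hk x

/-- The morphism of operads extending an isomorphism in dimensions `< n`. -/
noncomputable def extend (φ : LowIso G H) (hH : H.Contractible) : G ⟶ H :=
  Operad.Hom.mk (φ.extendColl hH)
    -- Both monoid laws are equalities of maps of collections into `H`, so by condition (ii) they
    -- reduce to dimensions below `n`, where `φ` respects identities and composites.
    (hH.2.hom_ext fun hk _ => (φ.extendColl_app hH hk _).trans (φ.map_id hk))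
    (hH.2.hom_ext fun {k} hk z => by
      refine (φ.extendColl_app hH hk _).trans ?_
      obtain ⟨⟨p, Λ⟩, h⟩ := z
      have hΛ := φ.extendColl_app hH hk Λ
      -- The relabelled pair is again composable: relabelling keeps the underlying shape of `p`, and
      -- `φ` keeps the shape of `Λ`.
      have h' : ((T n).map H.coll.left.bang).app hk.le
          (((T n).map (φ.extendColl hH).left).app hk.le p) = H.shape hk.le (φ.equiv hk Λ) := by
        rw [φ.map_shape]
        refine Eq.trans ?_ h
        exact congrArg (fun h : (T n).obj G.coll.left ⟶ shapes n => GSet.Hom.app h hk.le p)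
          (map_bang (φ.extendColl hH).left)
      refine (φ.map_composite hk p _ Λ h h'
        (relabel_map _ _ (fun hk x => φ.extendColl_app hH hk x) hk p)).trans ?_
      -- The two pairs share their pasting diagram; they differ only in whether `Λ` is moved by `φ`
      -- or by its extension.
      refine congrArg (H.composite hk.le) (Subtype.ext (Prod.ext rfl ?_))
      exact hΛ.symm)

theorem mapCell_extend (φ : LowIso G H) (hH : H.Contractible) {k : ℕ} (hk : k < n)
    (x : G.Cell k hk.le) : Operad.mapCell (φ.extend hH) hk.le x = φ.equiv hk x :=
  φ.extendColl_app hH hk x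

/-- The chosen top fillers need no comparison: both sides are operad morphisms into `G`, and below
`n` they agree because `φ` and its inverse cancel. -/
theorem extend_symm_comp (φ : LowIso G H) (hG : G.Contractible) (hH : H.Contractible) :
    φ.extend hH ≫ φ.symm.extend hG = 𝟙 G := by
  refine hG.2.operadHom_ext fun k hk x => ?_
  refine (φ.symm.mapCell_extend hG hk _).trans ?_
  refine (congrArg _ (φ.mapCell_extend hH hk x)).trans ?_
  exact (φ.equiv hk).symm_apply_apply x

theorem extend_comp_symm (φ : LowIso G H) (hG : G.Contractible) (hH : H.Contractible) :
    φ.symm.extend hG ≫ φ.extend hH = 𝟙 H := by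
  refine hH.2.operadHom_ext fun k hk x => ?_
  refine (φ.mapCell_extend hH hk _).trans ?_
  refine (congrArg _ (φ.symm.mapCell_extend hG hk x)).trans ?_
  exact (φ.equiv hk).apply_symm_apply x

/-- The isomorphism of contractible operads extending an isomorphism in dimensions `< n`. -/
noncomputable def extendIso (φ : LowIso G H) (hG : G.Contractible) (hH : H.Contractible) :
    G ≅ H where
  hom := φ.extend hH
  inv := φ.symm.extend hG
  hom_inv_id := φ.extend_symm_comp hG hH
  inv_hom_id := φ.extend_comp_symm hG hH

end LowIso

end NGlob

/-! ### The main theorem -/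

theorem mainTheorem12 (n : ℕ) :
    (∀ G : NGlob.Operad.{u} n, G.Contractible →
      (∀ (k : ℕ) (hk : k + 1 = n) (x x' : G.Cell k (Nat.le_of_succ_le hk.le))
        (τ : (NGlob.shapes.{u} n).cell (k + 1) hk.le),
        G.coll.left.Parallel _ x x' →
        G.shape _ x = NGlob.bdry hk.le τ → G.shape _ x' = NGlob.bdry hk.le τ →
        ∃! χ : G.Cell (k + 1) hk.le,
          G.src hk.le χ = x ∧ G.tgt hk.le χ = x' ∧ G.shape hk.le χ = τ) ∧
      (∀ (z : G.Composable n le_rfl) (χ : G.Cell n le_rfl),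
        G.IsCompositeFor le_rfl z χ ↔ χ = G.composite le_rfl z)) ∧
    (∀ G H : NGlob.Operad.{u} n, G.Contractible → H.Contractible →
      ∀ φ : NGlob.LowIso G H,
        ∃! e : G ≅ H, ∀ (k : ℕ) (hk : k < n) (x : G.Cell k hk.le),
          NGlob.Operad.mapCell e.hom hk.le x = φ.equiv hk x) ∧
    (∀ G H : NGlob.Operad.{u} n, H.TopUnique → ∀ f f' : G ⟶ H,
      (∀ (k : ℕ) (hk : k < n) (x : G.Cell k hk.le),
        NGlob.Operad.mapCell f hk.le x = NGlob.Operad.mapCell f' hk.le x) → f = f') := by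
  refine ⟨fun G hG => ⟨fun k hk x x' τ hp hx hx' => hG.existsUnique_fill hk x x' τ hp hx hx',
    hG.2.isCompositeFor_iff⟩, fun G H hG hH φ => ?_, fun G H hH f f' h => hH.operadHom_ext h⟩
  -- An isomorphism is determined by its forward morphism, so uniqueness of the extension is an
  -- instance of part 3.
  refine ⟨φ.extendIso hG hH, fun k hk x => φ.mapCell_extend hH hk x, fun e he => Iso.ext ?_⟩
  exact hH.2.operadHom_ext fun k hk x => (he k hk x).trans (φ.mapCell_extend hH hk x).symm
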